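/- **Setting.** A stream of message bits reaches an encoder. Let $B_t^*$ be the binary string received by time $t=1,2,\dots$, with $B_0^*$ empty. A bit arrival distribution is a family of transition laws $P_{B_{t+1}^*|B_t^*}$ of a Markov chain such that $P_{B_{t+1}^*|B_t^*}(\cdot|s)$ is supported on $\{s, s0, s1\}$ (at most one bit arrives at a time), and the first bit arrives at time $1$. Let $\tau_n$ be the arrival time of the $n$-th bit and $\bar\tau_n=\mathbb E[\tau_n]$. For every $n\ge 1$ let a bit arrival distribution (of messages of $n$ bits) be given, and let $P_{Y|X}:\{0,1\}\to\mathcal Y$, $|\mathcal Y|<\infty$, be a discrete memoryless channel of capacity $C>0$. Logarithms are to base $2$ and entropies are in bits. Assume: 1. $P_{B_{t+1}^*|B_t^*}(s|s)=1$ for all $s\in\{0,1\}^n$ (the message has $n$ bits); 2. $\bar\tau_n<\infty$ and $\mathbb P[\tau_n\le\bar\tau_n+d(n)]=1$ for a function $d:\mathbb N\to\mathbb N$ with $d(n)=o(n)$; 3. the capacity is achieved by the input distribution $P_X^*(0)=P_X^*(1)=\tfrac12$; 4. $C_1=\max_{x_1,x_2}D(P_{Y|X=x_1}\|P_{Y|X=x_2})$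 is attained at $(x_1,x_2)=(0,1)$; 5. $P_{Y|X}(y|x)>0$ for all $x,y$. **Codes.** An $(n,s,\epsilon)$ feedback code with instantaneous encoding consists of encoding functions giving channel inputs $X_t=f_t(B_t^*,Y^{t-1})$, decoding functions $g_t:\mathcal Y^t\to\{0,1\}^n$, and a stopping time $\lambda\ge1$ of the filtration generated by the channel outputs $Y_1,Y_2,\dots$, such that $\mathbb E[\lambda]\le s$ and $\mathbb P[g_\lambda(Y^\lambda)\ne B^*_{\tau_n}]\le\epsilon$. Let $\epsilon_n^*(R)$ be the infimum of all $\epsilon$ for which an $(n,n/R,\epsilon)$ code exists, and let $$E(R)=\liminf_{n\to\infty}\frac Rn\log_2\frac1{\epsilon_n^*(R)}$$ be the reliability function. **Instantaneous SED encoder.** At time $t$, given $Y^{t-1}=y^{t-1}$, the strings are partitioned into two groups $\mathcal G_0(t),\mathcal G_1(t)$ according to the prior $\pi=P_{B_t^*|Y^{t-1}}(\cdot|y^{t-1})$, so that $\pi(\mathcal G_0(t))\ge\pi(\mathcal G_1(t))$ and $\sum_x|\pi(\mathcal G_x(t))-\tfrac12|$ is minimal among all partitions; the input $X_t$ is the index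 of the group containing $B_t^*$. The priors are computed recursively from the arrival distribution and Bayes' rule. **Theorem.** Put $T_n=\lfloor\bar\tau_n\rfloor+d(n)$. For every $R>0$ and any choice of the instantaneous SED encoders (one for each $n$), $$E(R)\ \ge\ C_1\left(1-\limsup_{n\to\infty}\left(\frac{H(B^*_{T_n}\,|\,Y^{T_n})}{nC}+\frac{\bar\tau_n}{n}\right)R\right),$$ where $Y_1,Y_2,\dots$ are the channel outputs produced by the instantaneous SED encoder for messages of $n$ bits. (In particular this holds with $\lim$ in place of $\limsup$ whenever the limit exists.) -/

import Mathlib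

open MeasureTheory ProbabilityTheory Filter Topology
open scoped ENNReal

noncomputable section

namespace InstantSED

/-! ### Discrete-time processes with a given step-by-step law -/

section PathLaws

variable {E : Type*} [Countable E] [MeasurableSpace E] [MeasurableSingletonClass E]

/-- The conditional law of step `n + 1` given steps `0, …, n`, as a kernel. -/
def stepKernel (κ : (t : ℕ) → (Fin t → E) → PMF E) (n : ℕ) :
    Kernel (Π _ : Finset.Iic n, E) E :=
  Kernel.ofFunOfCountable fun h =>
    (κ (n + 1) fun i => h ⟨i, Finset.mem_Iic.2 (Nat.lt_succ_iff.1 i.2)⟩).toMeasure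

instance (κ : (t : ℕ) → (Fin t → E) → PMF E) (n : ℕ) : IsMarkovKernel (stepKernel κ n) :=
  ⟨fun h => by
    change IsProbabilityMeasure
      ((κ (n + 1) fun i => h ⟨i, Finset.mem_Iic.2 (Nat.lt_succ_iff.1 i.2)⟩).toMeasure)
    infer_instance⟩

/-- The law on infinite paths `ω : ℕ → E` such that, given the first `t` entries `h : Fin t → E`,
the next entry `ω t` has law `κ t h` (Ionescu-Tulcea). -/
def pathLaw (κ : (t : ℕ) → (Fin t → E) → PMF E) : Measure (ℕ → E) :=
  Kernel.trajMeasure (X := fun _ => E) (κ 0 fun i => i.elim0).toMeasure (stepKernel κ)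

end PathLaws

/-! ### Bit arrivals -/

instance : MeasurableSpace (List Bool) := ⊤

instance : DiscreteMeasurableSpace (List Bool) := ⟨fun _ => trivial⟩

/-- A bit arrival distribution. `trans t s` is the law of the string `B_{t+1}` received by time
`t + 1` given that `B_t = s`, where `B_0` is the empty string. At most one bit arrives at each
time, and the first bit arrives at time `1`. -/
structure BitArrival where
  trans : ℕ → List Bool → PMF (List Bool)
  support_subset : ∀ t s, (trans t s).support ⊆ {s, s ++ [false], s ++ [true]}
  first_bit : trans 0 [] [] = 0

/-- The last entry of a history of received strings (the empty string for the empty history). -/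
def lastBits : (t : ℕ) → (Fin t → List Bool) → List Bool
  | 0, _ => []
  | t + 1, h => h (Fin.last t)

/-- `B_t` along a path `b`, whose entry `b k` is the string received by time `k + 1`. -/
def bitsAt (b : ℕ → List Bool) : ℕ → List Bool
  | 0 => []
  | t + 1 => b t

/-- The law of the path `(B_1, B_2, …)`. -/
def BitArrival.law (A : BitArrival) : Measure (ℕ → List Bool) :=
  pathLaw fun t h => A.trans t (lastBits t h)

/-- `τ_n`: the time at which the `n`-th bit arrives (`⊤` if it never does). -/
def arrivalTime (n : ℕ) (b : ℕ → List Bool) : ℕ∞ :=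
  ⨅ (t : ℕ) (_ : n ≤ (bitsAt b t).length), (t : ℕ∞)

/-- `E[τ_n]`. -/
def BitArrival.meanArrival (A : BitArrival) (n : ℕ) : ℝ≥0∞ :=
  ∫⁻ b, (arrivalTime n b : ℝ≥0∞) ∂A.law

/-! ### Information measures of discrete memoryless channels, in bits -/

section Channel

variable {𝒳 𝒴 : Type*} [Fintype 𝒳] [Fintype 𝒴]

/-- Relative entropy `D(P‖Q)` (for `Q` positive on the support of `P`). -/
def relEntropy (P Q : PMF 𝒴) : ℝ :=
  ∑ y, (P y).toReal * Real.logb 2 ((P y).toReal / (Q y).toReal)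

/-- Mutual information between input and output of the channel `W` for the input law `P`. -/
def mutualInfo (W : 𝒳 → PMF 𝒴) (P : PMF 𝒳) : ℝ :=
  ∑ x, (P x).toReal * relEntropy (W x) (P.bind W)

/-- The channel capacity `C`. -/
def capacity (W : 𝒳 → PMF 𝒴) : ℝ := ⨆ P : PMF 𝒳, mutualInfo W P

/-- `P` is a capacity-achieving input distribution. -/
def IsCapacityAchieving (W : 𝒳 → PMF 𝒴) (P : PMF 𝒳) : Prop :=
  ∀ Q : PMF 𝒳, mutualInfo W Q ≤ mutualInfo W P

/-- `C₁`: the maximum of `D(W x₁‖W x₂)` over pairs of inputs. -/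
def maxRelEntropy (W : 𝒳 → PMF 𝒴) : ℝ := ⨆ q : 𝒳 × 𝒳, relEntropy (W q.1) (W q.2)

end Channel

/-- Conditional entropy `H(U | V)` in bits of discrete random variables. -/
def condEntropy {Ω α β : Type*} [MeasurableSpace Ω] [Fintype β] (μ : Measure Ω)
    (U : Ω → α) (V : Ω → β) : ℝ :=
  ∑ v, μ.real (V ⁻¹' {v}) *
    ∑' u, Real.negMulLog ((μ[|V ⁻¹' {v}]).real (U ⁻¹' {u})) / Real.log 2

/-! ### Feedback codes with instantaneous encoding -/

/-- Encoding functions: `f t b y` is the channel input at time `t + 1` when the string received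
by time `t + 1` is `b` and the channel outputs up to time `t` are `y`. -/
abbrev Encoder (𝒳 𝒴 : Type*) := (t : ℕ) → List Bool → (Fin t → 𝒴) → 𝒳

section System

variable {𝒳 𝒴 : Type*} [Fintype 𝒴] [MeasurableSpace 𝒴] [MeasurableSingletonClass 𝒴]

/-- The joint law of the path whose entry with index `t` is `(B_{t+1}, Y_{t+1})`: given the past,
`B_{t+1}` is drawn from the arrival distribution, and then `Y_{t+1}` is drawn from the channel
with input `f t B_{t+1} Y^t`. -/
def systemLaw (A : BitArrival) (W : 𝒳 → PMF 𝒴) (f : Encoder 𝒳 𝒴) :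
    Measure (ℕ → List Bool × 𝒴) :=
  pathLaw fun t h =>
    (A.trans t (lastBits t fun i => (h i).1)).bind fun b =>
      (W (f t b fun i => (h i).2)).map fun y => (b, y)

/-- The path of received strings. -/
def bitPath (ω : ℕ → List Bool × 𝒴) : ℕ → List Bool := fun t => (ω t).1

/-- The channel outputs `Y^t = (Y_1, …, Y_t)`. -/
def outputs (t : ℕ) (ω : ℕ → List Bool × 𝒴) : Fin t → 𝒴 := fun i => (ω i).2

/-- The filtration generated by the channel outputs. -/
def outputFiltration (𝒴 : Type*) [Fintype 𝒴] [MeasurableSpace 𝒴] [MeasurableSingletonClass 𝒴] :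
    Filtration ℕ (inferInstance : MeasurableSpace (ℕ → List Bool × 𝒴)) where
  seq t := MeasurableSpace.comap (outputs t) inferInstance
  mono' s t h := by
    have hst : (outputs s : (ℕ → List Bool × 𝒴) → Fin s → 𝒴) =
        (fun y : Fin t → 𝒴 => fun i => y (Fin.castLE h i)) ∘ outputs t := rfl
    change MeasurableSpace.comap (outputs s) _ ≤ MeasurableSpace.comap (outputs t) _
    rw [hst, ← MeasurableSpace.comap_comp]
    exact MeasurableSpace.comap_mono
      (measurable_pi_lambda _ fun i => measurable_pi_apply _).comap_le
  le' t := (measurable_pi_lambda _ fun i =>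
    measurable_snd.comp (measurable_pi_apply (i : ℕ)) : Measurable (outputs t)).comap_le

/-- An `(n, s, ε)` feedback code with instantaneous encoding: an encoder, decoding functions
and a stopping time of the output filtration with mean at most `s`, such that the string decoded
at the stopping time differs from `B_{τ_n}` with probability at most `ε`. -/
structure FeedbackCode (A : BitArrival) (W : 𝒳 → PMF 𝒴) (n : ℕ) (s ε : ℝ≥0∞) where
  enc : Encoder 𝒳 𝒴
  dec : (t : ℕ) → (Fin t → 𝒴) → List.Vector Bool n
  stopTime : (ℕ → List Bool × 𝒴) → ℕ∞
  isStoppingTime : IsStoppingTime (outputFiltration 𝒴) stopTime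
  one_le_stopTime : ∀ ω, 1 ≤ stopTime ω
  mean_le : ∫⁻ ω, (stopTime ω : ℝ≥0∞) ∂systemLaw A W enc ≤ s
  error_le : systemLaw A W enc
    {ω | ∃ t k : ℕ, stopTime ω = t ∧ arrivalTime n (bitPath ω) = k ∧
      (dec t (outputs t ω)).toList = bitsAt (bitPath ω) k}ᶜ ≤ ε

/-- `ε_n^*(R)`: the least error probability of `(n, n / R, ε)` codes. -/
def minError (A : BitArrival) (W : 𝒳 → PMF 𝒴) (n : ℕ) (R : ℝ) : ℝ≥0∞ :=
  sInf {ε | Nonempty (FeedbackCode A W n (ENNReal.ofReal (n / R)) ε)}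

/-- The reliability function `E(R) = lim (R / n) log₂ (1 / ε_n^*(R))`, where `A n` is the arrival
distribution of the messages of `n` bits; as a lower limit, so that it exists in `[-∞, ∞]`. -/
def reliability (A : ℕ → BitArrival) (W : 𝒳 → PMF 𝒴) (R : ℝ) : EReal :=
  liminf (fun n : ℕ =>
    ((R / n : ℝ) : EReal) * (ENNReal.log (minError (A n) W n R)⁻¹ / (Real.log 2 : ℝ))) atTop

end System

/-! ### The instantaneous SED code -/

section SED

variable {𝒳 𝒴 : Type*} [Fintype 𝒳]

/-- The mass that `π` gives to the group `G_x` of the strings that `g` sends to `x`. -/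
def groupMass (π : List Bool → ℝ≥0∞) (g : List Bool → 𝒳) (x : 𝒳) : ℝ≥0∞ :=
  ∑' i, (g ⁻¹' {x}).indicator π i

/-- The posterior of the string `i` after the channel output `y`, if the prior is `π` and the
group index `g` is transmitted (Bayes' rule). -/
def posterior (W : 𝒳 → PMF 𝒴) (π : List Bool → ℝ≥0∞) (g : List Bool → 𝒳) (y : 𝒴)
    (i : List Bool) : ℝ≥0∞ :=
  W (g i) y * π i / ∑ x, W x y * groupMass π g x

/-- `prior A W f t y i` is the prior of the string `i` at time `t + 1`: the conditional
probability of `B_{t+1} = i` given the outputs `Y^t = y`, computed recursively. -/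
def prior (A : BitArrival) (W : 𝒳 → PMF 𝒴) (f : Encoder 𝒳 𝒴) :
    (t : ℕ) → (Fin t → 𝒴) → List Bool → ℝ≥0∞
  | 0, _ => fun i => A.trans 0 [] i
  | t + 1, y => fun i => ∑' j, A.trans (t + 1) j i *
      posterior W (prior A W f t (Fin.init y)) (fun k => f t k (Fin.init y)) (y (Fin.last t)) j

/-- `f` is the encoder of an instantaneous SED code for the target input distribution `P`: at
each time, it transmits the index of the group that contains the received string, where the groups
have masses ordered like the values of `P` (equal values of `P`: in the order of the alphabet),
and minimize the distance of the group masses to `P` among all partitions. -/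
def IsSEDEncoder [LinearOrder 𝒳] (A : BitArrival) (W : 𝒳 → PMF 𝒴) (P : PMF 𝒳)
    (f : Encoder 𝒳 𝒴) : Prop :=
  ∀ (t : ℕ) (y : Fin t → 𝒴),
    (∀ a b : 𝒳, (P b < P a ∨ P a = P b ∧ a < b) →
      groupMass (prior A W f t y) (fun i => f t i y) b ≤
        groupMass (prior A W f t y) (fun i => f t i y) a) ∧
    ∀ g : List Bool → 𝒳,
      ∑ x, |(groupMass (prior A W f t y) (fun i => f t i y) x).toReal - (P x).toReal| ≤
        ∑ x, |(groupMass (prior A W f t y) g x).toReal - (P x).toReal|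

end SED

end InstantSED

end

open InstantSED

namespace InstantSED

/-! By time `T`, the rounded mean arrival time plus `d n`, the whole message has arrived almost
surely. The code follows the given encoder up to `T`, then performs posterior matching on the now
fixed message, and stops as soon as some message has posterior at least `1 - ε`. Bayes' rule gives
error at most `ε`, so only the mean stopping time has to be bounded.

That bound comes from a potential of the log-likelihood ratio `l` of the true message that grows on
average by at least one per channel use. While `l ≤ 0`, the near-balanced partition yields a mean
increment of `l` of at least the capacity, so slope `1 / C₀` suffices. Once `l > 0`, the true
message is alone in group `0`, the mean increment is the divergence `C₁`, and the slope is `1 / C₁`.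
The two lines are glued by a multiple of `1 - exp (-l)`: in the second regime `exp (-l)` is a
martingale, so this term costs no drift, while near zero it compensates for the overshoot of one
step.

At time `T` the average potential is at least `-H / C`, with `H` the remaining conditional entropy;
upon stopping it is at most `log (1 / ε) / C₁ + O(1)`. Hence the mean stopping time is at most `T +
H / C + log (1 / ε) / C₁ + O(1)`. Equating this with `n / R` and solving for `ε` gives the exponent.

All averages are finite sums over unnormalized joint weights of messages and output sequences, so
the martingale argument becomes a telescoping sum. The carrying lemmas are
`isUniformChannel_of_isCapacityAchieving`, `avgPotential_drift`, `systemLaw_switchEncoder_real`,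
`switchDeficit_succ_le`, `switchDeficit_le` and `exists_feedbackCode`. -/

/-- The first `t` entries of a path. -/
def pathPrefix {E : Type*} (t : ℕ) (ω : ℕ → E) : Fin t → E := fun i => ω i

lemma measurable_pathPrefix {E : Type*} [MeasurableSpace E] (t : ℕ) :
    Measurable (pathPrefix (E := E) t) :=
  measurable_pi_lambda _ fun _ => measurable_pi_apply _

/-! ### Cylinder probabilities of path laws -/

section PathLaw

variable {E : Type*} [Countable E] [MeasurableSpace E] [MeasurableSingletonClass E]

instance (κ : (t : ℕ) → (Fin t → E) → PMF E) : IsProbabilityMeasure (pathLaw κ) := by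
  unfold pathLaw; infer_instance

lemma pathLaw_zero (κ : (t : ℕ) → (Fin t → E) → PMF E) (e : E) :
    pathLaw κ {ω | ω 0 = e} = κ 0 (fun i => i.elim0) e := by
  have h1 : (pathLaw κ).map (Preorder.frestrictLe (π := fun _ : ℕ => E) 0) =
      ((κ 0 fun i => i.elim0).toMeasure).map
        (MeasurableEquiv.piUnique (fun _ : Finset.Iic (0 : ℕ) => E)).symm := by
    unfold pathLaw Kernel.trajMeasure
    rw [Measure.map_comp _ _ (by fun_prop), Kernel.traj_map_frestrictLe,
      Kernel.partialTraj_self, Measure.id_comp]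
  have h2 : {ω : ℕ → E | ω 0 = e} = Preorder.frestrictLe (π := fun _ : ℕ => E) 0 ⁻¹'
      {h | h ⟨0, by simp⟩ = e} := rfl
  have hm : MeasurableSet {h : Π _ : Finset.Iic (0 : ℕ), E | h ⟨0, by simp⟩ = e} :=
    measurable_pi_apply (X := fun _ : Finset.Iic (0 : ℕ) => E) _ (measurableSet_singleton e)
  rw [h2, ← Measure.map_apply (by fun_prop) hm, h1, Measure.map_apply (by fun_prop) hm,
    ← PMF.toMeasure_apply_singleton _ _ (measurableSet_singleton e)]
  rfl

lemma pathLaw_succ (κ : (t : ℕ) → (Fin t → E) → PMF E) (t : ℕ) (h : Fin (t + 1) → E) (e : E) :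
    pathLaw κ {ω | pathPrefix (t + 1) ω = h ∧ ω (t + 1) = e} =
      pathLaw κ {ω | pathPrefix (t + 1) ω = h} * κ (t + 1) h e := by
  let h' : Π _ : Finset.Iic t, E := fun i => h ⟨i, Nat.lt_succ_of_le (Finset.mem_Iic.1 i.2)⟩
  have key (ω : ℕ → E) : pathPrefix (t + 1) ω = h ↔
      Preorder.frestrictLe (π := fun _ : ℕ => E) t ω = h' := by
    constructor
    · rintro rfl; rfl
    · intro H
      ext i
      exact congrFun H ⟨i, Finset.mem_Iic.2 (Nat.lt_succ_iff.1 i.2)⟩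
  have := Kernel.map_frestrictLe_trajMeasure_compProd_eq_map_trajMeasure
    (X := fun _ => E) (μ₀ := (κ 0 fun i => i.elim0).toMeasure) (κ := stepKernel κ) (a := t)
  have := congrArg (fun μ => μ ({h'} ×ˢ {e})) this
  rw [Measure.compProd_apply_prod (measurableSet_singleton _) (measurableSet_singleton _),
    Measure.map_apply (by fun_prop)
      ((measurableSet_singleton _).prod (measurableSet_singleton _)),
    lintegral_singleton, Measure.map_apply (by fun_prop) (measurableSet_singleton _)] at this
  have e1 : {ω | pathPrefix (t + 1) ω = h ∧ ω (t + 1) = e} =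
      (fun x : ℕ → E => (Preorder.frestrictLe (π := fun _ : ℕ => E) t x, x (t + 1))) ⁻¹'
        ({h'} ×ˢ {e}) := by
    ext ω; simp [key]
  have e2 : {ω | pathPrefix (t + 1) ω = h} =
      Preorder.frestrictLe (π := fun _ : ℕ => E) t ⁻¹' {h'} := by
    ext ω; simp [key]
  rw [e1, e2]
  refine this.symm.trans ?_
  rw [mul_comm]
  congr 1
  exact PMF.toMeasure_apply_singleton _ _ (measurableSet_singleton e)

/-- Given the first `t` entries `h`, the next entry has law `κ t h`. -/
lemma pathLaw_step (κ : (t : ℕ) → (Fin t → E) → PMF E) (t : ℕ) (h : Fin t → E) (e : E) :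
    pathLaw κ {ω | pathPrefix t ω = h ∧ ω t = e} =
      pathLaw κ {ω | pathPrefix t ω = h} * κ t h e := by
  cases t with
  | zero =>
    have h0 (g : Fin 0 → E) : g = h := Subsingleton.elim _ _
    simp only [h0, true_and, Set.ofPred_true, measure_univ, one_mul, pathLaw_zero]
  | succ t => exact pathLaw_succ κ t h e

lemma pathLaw_step_mem (κ : (t : ℕ) → (Fin t → E) → PMF E) (t : ℕ) (h : Fin t → E) (F : Set E) :
    pathLaw κ {ω | pathPrefix t ω = h ∧ ω t ∈ F} =
      pathLaw κ {ω | pathPrefix t ω = h} * (κ t h).toMeasure F := by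
  have : {ω | pathPrefix t ω = h ∧ ω t ∈ F} =
      ⋃ e ∈ F, {ω : ℕ → E | pathPrefix t ω = h ∧ ω t = e} := by
    ext ω; simp
  have hm (e : E) : MeasurableSet {ω : ℕ → E | pathPrefix t ω = h ∧ ω t = e} :=
    ((measurable_pathPrefix t) (measurableSet_singleton h)).inter
      (measurable_pi_apply (X := fun _ => E) t (measurableSet_singleton e))
  rw [this, measure_biUnion F.to_countable _ fun e _ => hm e]
  · refine (tsum_congr fun e : F => pathLaw_step κ t h e).trans ?_
    rw [ENNReal.tsum_mul_left]
    congr 1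
    conv_rhs => rw [← Set.biUnion_of_singleton F]
    rw [measure_biUnion F.to_countable _ fun e _ => measurableSet_singleton e]
    · rw [tsum_congr fun e : F => PMF.toMeasure_apply_singleton (κ t h) e.1
        (measurableSet_singleton _)]
    · intro a _ b _ hab
      simpa using hab
  · intro a _ b _ hab
    refine Set.disjoint_left.2 ?_
    rintro ω ⟨-, h1⟩ ⟨-, h2⟩
    exact hab (h1.symm.trans h2)

lemma pathLaw_prefix_mem (κ : (t : ℕ) → (Fin t → E) → PMF E) (t : ℕ) (S : Set (Fin t → E))
    (F : Set E) :
    pathLaw κ {ω | pathPrefix t ω ∈ S ∧ ω t ∈ F} =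
      ∑' h : S, pathLaw κ {ω | pathPrefix t ω = h} * (κ t h).toMeasure F := by
  have : {ω | pathPrefix t ω ∈ S ∧ ω t ∈ F} =
      ⋃ h ∈ S, {ω : ℕ → E | pathPrefix t ω = h ∧ ω t ∈ F} := by
    ext ω; simp
  have hm (h : Fin t → E) : MeasurableSet {ω : ℕ → E | pathPrefix t ω = h ∧ ω t ∈ F} :=
    ((measurable_pathPrefix t) (measurableSet_singleton h)).inter
      (measurable_pi_apply (X := fun _ => E) t F.to_countable.measurableSet)
  rw [this, measure_biUnion S.to_countable _ fun e _ => hm e]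
  · exact tsum_congr fun h : S => pathLaw_step_mem κ t h F
  · intro a _ b _ hab
    refine Set.disjoint_left.2 ?_
    rintro ω ⟨h1, -⟩ ⟨h2, -⟩
    exact hab (h1.symm.trans h2)

/-- If the conditional probability of a step into `F` is constantly `c` on the pasts in `S`. -/
lemma pathLaw_prefix_mem_of_const (κ : (t : ℕ) → (Fin t → E) → PMF E) (t : ℕ)
    (S : Set (Fin t → E)) (F : Set E) (c : ℝ≥0∞)
    (hc : ∀ h ∈ S, pathLaw κ {ω | pathPrefix t ω = h} ≠ 0 → (κ t h).toMeasure F = c) :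
    pathLaw κ {ω | pathPrefix t ω ∈ S ∧ ω t ∈ F} =
      pathLaw κ {ω | pathPrefix t ω ∈ S} * c := by
  have h1 := pathLaw_prefix_mem κ t S Set.univ
  simp only [Set.mem_univ, and_true, measure_univ, mul_one] at h1
  rw [pathLaw_prefix_mem, h1, ← ENNReal.tsum_mul_right]
  refine tsum_congr fun h => ?_
  by_cases h0 : pathLaw κ {ω | pathPrefix t ω = h} = 0
  · simp [h0]
  · rw [hc h h.2 h0]

lemma pathLaw_prefix_succ (κ : (t : ℕ) → (Fin t → E) → PMF E) (t : ℕ) (h : Fin (t + 1) → E) :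
    pathLaw κ {ω | pathPrefix (t + 1) ω = h} =
      pathLaw κ {ω | pathPrefix t ω = Fin.init h} * κ t (Fin.init h) (h (Fin.last t)) := by
  rw [← pathLaw_step]
  congr 1
  ext ω
  constructor
  · rintro rfl; exact ⟨rfl, rfl⟩
  · rintro ⟨h1, h2⟩
    ext i
    refine Fin.lastCases h2 (fun j => congrFun h1 j) i

/-- The law of the first `t` entries depends only on the first `t` conditional laws. -/
lemma pathLaw_prefix_congr (κ κ' : (t : ℕ) → (Fin t → E) → PMF E) (T : ℕ)
    (hκ : ∀ t < T, κ t = κ' t) (t : ℕ) (ht : t ≤ T) (h : Fin t → E) :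
    pathLaw κ {ω | pathPrefix t ω = h} = pathLaw κ' {ω | pathPrefix t ω = h} := by
  induction t with
  | zero =>
    have h0 (g : Fin 0 → E) : g = h := Subsingleton.elim _ _
    simp [h0]
  | succ t ih => rw [pathLaw_prefix_succ, pathLaw_prefix_succ, ih (by omega), hκ t (by omega)]

lemma measure_pathPrefix_mem (μ : Measure (ℕ → E)) (t : ℕ) (S : Set (Fin t → E)) :
    μ {ω | pathPrefix t ω ∈ S} = ∑' h : S, μ {ω | pathPrefix t ω = h} := by
  have : {ω | pathPrefix t ω ∈ S} = ⋃ h ∈ S, {ω : ℕ → E | pathPrefix t ω = h} := by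
    ext ω; simp
  have hm (h : Fin t → E) : MeasurableSet {ω : ℕ → E | pathPrefix t ω = h} :=
    (measurable_pathPrefix t) (measurableSet_singleton h)
  rw [this, measure_biUnion S.to_countable _ fun h _ => hm h]
  intro a _ b _ hab
  refine Set.disjoint_left.2 ?_
  intro ω h1 h2
  exact hab (h1.symm.trans h2)

/-- Almost surely every entry lies in the support of its conditional law. -/
lemma ae_pathLaw_mem_support (κ : (t : ℕ) → (Fin t → E) → PMF E) :
    ∀ᵐ ω ∂pathLaw κ, ∀ t, ω t ∈ (κ t (pathPrefix t ω)).support := by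
  rw [ae_all_iff]
  intro t
  have : {ω : ℕ → E | ¬ ω t ∈ (κ t (pathPrefix t ω)).support} ⊆
      ⋃ h : Fin t → E, ⋃ e ∈ ((κ t h).support)ᶜ, {ω : ℕ → E | pathPrefix t ω = h ∧ ω t = e} := by
    intro ω hω
    simp only [Set.mem_iUnion]
    exact ⟨pathPrefix t ω, ω t, hω, rfl, rfl⟩
  refine measure_mono_null this (measure_iUnion_null fun h => ?_)
  refine (measure_biUnion_null_iff (Set.to_countable _)).2 fun e he => ?_
  rw [pathLaw_step]
  have : κ t h e = 0 := by simpa [PMF.mem_support_iff] using he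
  rw [this, mul_zero]

end PathLaw

/-! ### Channels with a uniform capacity-achieving input distribution -/

section ChannelFacts

variable {𝒴 : Type*} [Fintype 𝒴]

/-- Transition probabilities bounded below by `m`, with the divergence properties of a binary input
channel whose capacity `C₀` (in nats) is achieved by the uniform distribution. -/
structure IsUniformChannel (w : Fin 2 → 𝒴 → ℝ) (m C₀ C₁ : ℝ) : Prop where
  m_pos : 0 < m
  m_le : ∀ x y, m ≤ w x y
  sum_eq : ∀ x, ∑ y, w x y = 1
  C₀_pos : 0 < C₀
  le_div : ∀ x x', x ≠ x' → ∀ α, 0 ≤ α → α ≤ 1 / 2 →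
    C₀ ≤ ∑ y, w x y * Real.log (w x y / (α * w x y + (1 - α) * w x' y))
  div_eq : ∑ y, w 0 y * Real.log (w 0 y / w 1 y) = C₁

/-- The probability law `(1/2 + u, 1/2 - u)` on two points. -/
noncomputable def tiltedBit (u : ℝ) (hu : |u| ≤ 1 / 2) : PMF (Fin 2) :=
  PMF.ofFintype (fun x => ENNReal.ofReal (if x = 0 then 1 / 2 + u else 1 / 2 - u)) (by
    have := abs_le.1 hu
    rw [Fin.sum_univ_two, ← ENNReal.ofReal_add (by simp; linarith) (by simp; linarith)]
    norm_num)

lemma tiltedBit_zero (u : ℝ) (hu : |u| ≤ 1 / 2) : (tiltedBit u hu 0).toReal = 1 / 2 + u := by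
  have := abs_le.1 hu
  simp only [tiltedBit, PMF.ofFintype_apply, if_true]
  exact ENNReal.toReal_ofReal (by linarith)

lemma tiltedBit_one (u : ℝ) (hu : |u| ≤ 1 / 2) : (tiltedBit u hu 1).toReal = 1 / 2 - u := by
  have := abs_le.1 hu
  simp only [tiltedBit, PMF.ofFintype_apply]
  exact ENNReal.toReal_ofReal (by simp; linarith)

lemma sum_toReal_pmf (p : PMF 𝒴) : ∑ y, (p y).toReal = 1 := by
  rw [← ENNReal.toReal_sum fun y _ => p.apply_ne_top y, ← tsum_fintype (L := .unconditional _),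
    p.tsum_coe, ENNReal.toReal_one]

lemma toReal_bind_fin_two {𝒴 : Type*} (W : Fin 2 → PMF 𝒴) (P : PMF (Fin 2)) (y : 𝒴) :
    (P.bind W y).toReal = (P 0).toReal * (W 0 y).toReal + (P 1).toReal * (W 1 y).toReal := by
  rw [PMF.bind_apply, tsum_fintype, Fin.sum_univ_two, ENNReal.toReal_add, ENNReal.toReal_mul,
    ENNReal.toReal_mul]
  all_goals exact ENNReal.mul_ne_top (PMF.apply_ne_top _ _) (PMF.apply_ne_top _ _)

lemma relEntropy_mul_log_two (P Q : PMF 𝒴) :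
    relEntropy P Q * Real.log 2 =
      ∑ y, (P y).toReal * Real.log ((P y).toReal / (Q y).toReal) := by
  have : Real.log 2 ≠ 0 := (Real.log_pos one_lt_two).ne'
  rw [relEntropy, Finset.sum_mul]
  refine Finset.sum_congr rfl fun y _ => ?_
  rw [Real.logb]; field_simp

lemma mutualInfo_fin_two (W : Fin 2 → PMF 𝒴) (P : PMF (Fin 2)) :
    mutualInfo W P = (P 0).toReal * relEntropy (W 0) (P.bind W) +
      (P 1).toReal * relEntropy (W 1) (P.bind W) := by
  rw [mutualInfo, Fin.sum_univ_two]

lemma capacity_eq_of_isCapacityAchieving {𝒳 : Type*} [Fintype 𝒳] {W : 𝒳 → PMF 𝒴} {P : PMF 𝒳}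
    (h : IsCapacityAchieving W P) : capacity W = mutualInfo W P := by
  have : Nonempty (PMF 𝒳) := ⟨P⟩
  exact le_antisymm (ciSup_le h) (le_ciSup ⟨mutualInfo W P, by rintro _ ⟨Q, rfl⟩; exact h Q⟩ P)

/-- First-order condition at an interior maximum: dividing by small `u` of either sign kills the
linear coefficient. It is applied to the mutual information near the uniform input. -/
lemma eq_zero_of_forall_mul_le_sq {δ κ : ℝ} (hκ : 0 ≤ κ)
    (h : ∀ u : ℝ, |u| ≤ 1 / 2 → u * δ ≤ κ * u ^ 2) : δ = 0 := by
  have key : ∀ δ : ℝ, (∀ u : ℝ, |u| ≤ 1 / 2 → u * δ ≤ κ * u ^ 2) → δ ≤ 0 := by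
    intro δ h
    by_contra! hδ
    set u := min (1 / 2) (δ / (2 * (κ + 1))) with hu
    have hu0 : 0 < u := lt_min (by norm_num) (by positivity)
    have h1 := h u (by rw [abs_of_pos hu0]; exact min_le_left _ _)
    have h2 : u ≤ δ / (2 * (κ + 1)) := min_le_right _ _
    have h3 : δ ≤ κ * u := by
      refine le_of_mul_le_mul_left ?_ hu0
      calc u * δ ≤ κ * u ^ 2 := h1
        _ = u * (κ * u) := by ring
    rw [le_div_iff₀ (by positivity)] at h2
    nlinarith
  refine le_antisymm (key δ h) ?_
  have := key (-δ) fun u hu => by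
    have := h (-u) (by rwa [abs_neg])
    nlinarith
  linarith

/-- If the uniform distribution achieves capacity, then both inputs have divergence `C` from the
output distribution. -/
lemma relEntropy_eq_capacity {W : Fin 2 → PMF 𝒴} (h_full : ∀ x y, 0 < W x y)
    (h : IsCapacityAchieving W (PMF.uniformOfFintype (Fin 2))) (x : Fin 2) :
    ∑ y, (W x y).toReal *
      Real.log ((W x y).toReal / (((W 0 y).toReal + (W 1 y).toReal) / 2)) =
      capacity W * Real.log 2 := by
  have hl2 : 0 < Real.log 2 := Real.log_pos one_lt_two
  have hw : ∀ x y, 0 < (W x y).toReal := fun x y =>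
    ENNReal.toReal_pos (h_full x y).ne' (PMF.apply_ne_top _ _)
  set w : Fin 2 → 𝒴 → ℝ := fun x y => (W x y).toReal with hwdef
  set D : Fin 2 → ℝ := fun x => ∑ y, w x y * Real.log (w x y / ((w 0 y + w 1 y) / 2)) with hD
  have hsum : ∀ x, ∑ y, w x y = 1 := fun x => sum_toReal_pmf (W x)
  have hmi (u : ℝ) (hu : |u| ≤ 1 / 2) : mutualInfo W (tiltedBit u hu) * Real.log 2 =
      (1 / 2 + u) * ∑ y, w 0 y * Real.log (w 0 y / ((1 / 2 + u) * w 0 y + (1 / 2 - u) * w 1 y)) +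
      (1 / 2 - u) *
        ∑ y, w 1 y * Real.log (w 1 y / ((1 / 2 + u) * w 0 y + (1 / 2 - u) * w 1 y)) := by
    rw [mutualInfo_fin_two, add_mul, mul_assoc, mul_assoc, relEntropy_mul_log_two,
      relEntropy_mul_log_two]
    simp only [toReal_bind_fin_two, tiltedBit_zero, tiltedBit_one, hwdef]
  have hunif : PMF.uniformOfFintype (Fin 2) = tiltedBit 0 (by norm_num) := by
    ext x
    refine (ENNReal.toReal_eq_toReal_iff' (PMF.apply_ne_top _ _) (PMF.apply_ne_top _ _)).1 ?_
    fin_cases x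
    · simp [tiltedBit_zero]
    · simp [tiltedBit_one]
  have hcap : capacity W * Real.log 2 = (D 0 + D 1) / 2 := by
    rw [capacity_eq_of_isCapacityAchieving h, hunif, hmi]
    have : ∀ y, (1 / 2 + 0) * w 0 y + (1 / 2 - 0) * w 1 y = (w 0 y + w 1 y) / 2 :=
      fun y => by ring
    simp only [this, hD]; ring
  set κ : ℝ := ∑ y, (w 0 y - w 1 y) ^ 2 / ((w 0 y + w 1 y) / 2) with hκ
  have hκ0 : 0 ≤ κ := Finset.sum_nonneg fun y _ => by
    have := hw 0 y; have := hw 1 y; positivity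
  have hdiff : D 0 - D 1 = 0 := by
    refine eq_zero_of_forall_mul_le_sq hκ0 fun u hu => ?_
    have hu' := abs_le.1 hu
    have hle : mutualInfo W (tiltedBit u hu) * Real.log 2 ≤ (D 0 + D 1) / 2 := by
      rw [← hcap, capacity_eq_of_isCapacityAchieving h]
      exact mul_le_mul_of_nonneg_right (h _) hl2.le
    -- Replacing the output law `p` by the balanced law `s` costs exactly the divergence of `p` from
    -- `s`, which is at most their chi-square distance `κ * u ^ 2`.
    have hlow : (1 / 2 + u) * D 0 + (1 / 2 - u) * D 1 - κ * u ^ 2 ≤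
        mutualInfo W (tiltedBit u hu) * Real.log 2 := by
      rw [hmi, hD, hκ]
      simp only [Finset.mul_sum, Finset.sum_mul]
      -- Subtracting this vanishing sum supplies the linear part of `p * (p / s - 1)`, so the
      -- inequality can be checked output by output.
      have hz : ∑ y, u * (w 0 y - w 1 y) = 0 := by
        rw [← Finset.mul_sum, Finset.sum_sub_distrib, hsum, hsum]; ring
      rw [← Finset.sum_add_distrib, ← Finset.sum_add_distrib, ← Finset.sum_sub_distrib,
        ← sub_zero (Finset.sum _ _), ← hz, ← Finset.sum_sub_distrib]
      refine Finset.sum_le_sum fun y _ => ?_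
      have h0 := hw 0 y
      have h1 := hw 1 y
      change 0 < w 0 y at h0
      change 0 < w 1 y at h1
      generalize w 0 y = a at *
      generalize w 1 y = b at *
      have hs : 0 < (a + b) / 2 := by positivity
      have hp : 0 < (1 / 2 + u) * a + (1 / 2 - u) * b := by
        rcases le_or_gt 0 u with hu0 | hu0
        · have : 0 ≤ (1 / 2 - u) * b := mul_nonneg (by linarith) h1.le
          have : 0 < (1 / 2 + u) * a := mul_pos (by linarith) h0
          linarith
        · have : 0 < (1 / 2 - u) * b := mul_pos (by linarith) h1
          have : 0 ≤ (1 / 2 + u) * a := mul_nonneg (by linarith) h0.le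
          linarith
      set p := (1 / 2 + u) * a + (1 / 2 - u) * b with hpdef
      set s := (a + b) / 2 with hsdef
      have hlog := Real.log_le_sub_one_of_pos (div_pos hp hs)
      rw [Real.log_div hp.ne' hs.ne'] at hlog
      rw [Real.log_div h0.ne' hs.ne', Real.log_div h0.ne' hp.ne', Real.log_div h1.ne' hs.ne',
        Real.log_div h1.ne' hp.ne']
      have hmul := mul_le_mul_of_nonneg_left hlog hp.le
      have hps : p * (p / s - 1) = (a - b) ^ 2 / s * u ^ 2 + u * (a - b) := by
        have : p = s + u * (a - b) := by rw [hpdef, hsdef]; ring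
        rw [this]; field_simp; ring
      have hexp : p * (Real.log p - Real.log s) =
          (1 / 2 + u) * (a * (Real.log p - Real.log s)) +
          (1 / 2 - u) * (b * (Real.log p - Real.log s)) := by rw [hpdef]; ring
      linarith
    linarith
  rw [hcap]
  have : D x = D 0 := by
    fin_cases x
    · rfl
    · change D 1 = D 0; linarith
  change D x = _
  rw [this]; linarith

/-- Here `m` is the least transition probability, and the factors `log 2` convert bits to nats. For
the divergence bound, the reference law at `α = 1 / 2` gives exactly the capacity, and moving it
away from `W x` can only increase the divergence. -/
lemma isUniformChannel_of_isCapacityAchieving {W : Fin 2 → PMF 𝒴} (h_full : ∀ x y, 0 < W x y)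
    (h_pos : 0 < capacity W) (h : IsCapacityAchieving W (PMF.uniformOfFintype (Fin 2)))
    (h_max : relEntropy (W 0) (W 1) = maxRelEntropy W) :
    ∃ m, IsUniformChannel (fun x y => (W x y).toReal) m (capacity W * Real.log 2)
      (maxRelEntropy W * Real.log 2) := by
  have hl2 : 0 < Real.log 2 := Real.log_pos one_lt_two
  have hw : ∀ x y, 0 < (W x y).toReal := fun x y =>
    ENNReal.toReal_pos (h_full x y).ne' (PMF.apply_ne_top _ _)
  have h𝒴 : Nonempty 𝒴 := (W 0).support_nonempty.to_type
  obtain ⟨p, -, hp⟩ := Finset.exists_min_image (Finset.univ : Finset (Fin 2 × 𝒴))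
    (fun p => (W p.1 p.2).toReal) Finset.univ_nonempty
  refine ⟨(W p.1 p.2).toReal, hw _ _, fun x y => hp (x, y) (Finset.mem_univ _),
    fun x => sum_toReal_pmf (W x), by positivity, ?_, ?_⟩
  · intro x x' hx α h0 h1
    -- With this weight the balanced output law is a convex combination of the mixture and `W x`;
    -- concavity of the logarithm then compares the two divergences.
    set lam : ℝ := 1 / (2 * (1 - α)) with hlam
    have hα : 0 < 1 - α := by linarith
    have hlam0 : 0 < lam := by positivity
    have hlam1 : lam ≤ 1 := by
      rw [hlam, div_le_one (by positivity)]; linarith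
    have hC := relEntropy_eq_capacity h_full h x
    have hle : capacity W * Real.log 2 ≤ lam * ∑ y, (W x y).toReal *
        Real.log ((W x y).toReal / (α * (W x y).toReal + (1 - α) * (W x' y).toReal)) := by
      rw [← hC, Finset.mul_sum]
      refine Finset.sum_le_sum fun y _ => ?_
      have ha := hw x y
      have hb := hw x' y
      have hs : (W 0 y).toReal + (W 1 y).toReal = (W x y).toReal + (W x' y).toReal := by
        fin_cases x <;> fin_cases x' <;> simp_all [add_comm]
      rw [hs]
      generalize (W x y).toReal = a at *
      generalize (W x' y).toReal = b at *
      have hq : 0 < α * a + (1 - α) * b := by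
        have : 0 ≤ α * a := by positivity
        have : 0 < (1 - α) * b := by positivity
        linarith
      rw [Real.log_div ha.ne' (by positivity), Real.log_div ha.ne' hq.ne']
      have hc := strictConcaveOn_log_Ioi.concaveOn.2 (Set.mem_Ioi.2 hq) (Set.mem_Ioi.2 ha)
        hlam0.le (by linarith : 0 ≤ 1 - lam) (by ring)
      simp only [smul_eq_mul] at hc
      have hmix : lam * (α * a + (1 - α) * b) + (1 - lam) * a = (a + b) / 2 := by
        rw [hlam]; field_simp; ring
      rw [hmix] at hc
      have := mul_le_mul_of_nonneg_left hc ha.le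
      linarith
    set S := ∑ y, (W x y).toReal *
        Real.log ((W x y).toReal / (α * (W x y).toReal + (1 - α) * (W x' y).toReal))
    have hcl : 0 < capacity W * Real.log 2 := by positivity
    have hS : 0 < S := by
      by_contra! hS
      have := mul_nonpos_of_nonneg_of_nonpos hlam0.le hS
      linarith
    nlinarith
  · rw [← h_max, relEntropy_mul_log_two]

end ChannelFacts

/-! ### A potential function for posterior matching -/

section Potential

variable {𝒴 : Type*} [Fintype 𝒴] {w : Fin 2 → 𝒴 → ℝ} {m C₀ C₁ : ℝ}

/-- The potential of a message whose log-likelihood ratio is `l`. -/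
noncomputable def potential (m C₀ C₁ l : ℝ) : ℝ :=
  if l ≤ 0 then l / C₀ else l / C₁ + 1 / (m * C₀) * (1 - Real.exp (-l))

namespace IsUniformChannel

lemma w_pos (hw : IsUniformChannel w m C₀ C₁) (x : Fin 2) (y : 𝒴) : 0 < w x y :=
  hw.m_pos.trans_le (hw.m_le x y)

lemma w_le_one (hw : IsUniformChannel w m C₀ C₁) (x : Fin 2) (y : 𝒴) : w x y ≤ 1 := by
  rw [← hw.sum_eq x]
  exact Finset.single_le_sum (fun y _ => (hw.w_pos x y).le) (Finset.mem_univ y)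

lemma nonempty (hw : IsUniformChannel w m C₀ C₁) : Nonempty 𝒴 := by
  by_contra h
  rw [not_nonempty_iff] at h
  simpa using hw.sum_eq 0

lemma m_le_one (hw : IsUniformChannel w m C₀ C₁) : m ≤ 1 := by
  obtain ⟨y⟩ := hw.nonempty
  exact (hw.m_le 0 y).trans (hw.w_le_one 0 y)

lemma C₁_pos (hw : IsUniformChannel w m C₀ C₁) : 0 < C₁ := by
  have := hw.le_div 0 1 (by decide) 0 le_rfl (by norm_num)
  simp only [zero_mul, zero_add, sub_zero, one_mul, hw.div_eq] at this
  exact hw.C₀_pos.trans_le this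

/-- One step from `l ≤ 0` reaches at most `-log m`. Up to there the exponential term keeps the
potential above the line of slope `1 / C₀`, because `1 - exp (-l) ≥ l * exp (-l) ≥ l * m`. -/
lemma div_le_potential (hw : IsUniformChannel w m C₀ C₁) {l : ℝ} (hl : l ≤ -Real.log m) :
    l / C₀ ≤ potential m C₀ C₁ l := by
  have hm := hw.m_pos
  have hC₀ := hw.C₀_pos
  have hC₁ := hw.C₁_pos
  unfold potential
  split_ifs with h
  · exact le_rfl
  · push Not at h
    have h1 : m ≤ Real.exp (-l) := by
      rw [← Real.exp_log hm]; exact Real.exp_le_exp.2 (by linarith)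
    have h2 : l * m ≤ 1 - Real.exp (-l) := by
      have h3 : l + 1 ≤ Real.exp l := Real.add_one_le_exp l
      have h4 : Real.exp (-l) * Real.exp l = 1 := by rw [← Real.exp_add]; simp
      have h5 : 0 < Real.exp (-l) := Real.exp_pos _
      nlinarith
    have h6 : l / C₀ = 1 / (m * C₀) * (l * m) := by field_simp
    have h7 : 0 ≤ l / C₁ := by positivity
    have h8 : 1 / (m * C₀) * (l * m) ≤ 1 / (m * C₀) * (1 - Real.exp (-l)) :=
      mul_le_mul_of_nonneg_left h2 (by positivity)
    linarith

/-- The formula of the positive branch is a lower bound everywhere, so a step that falls from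
positive to negative `l` needs no case distinction. Below zero this uses `1 - exp (-l) ≤ l` and `m ≤
1`. -/
lemma le_potential (hw : IsUniformChannel w m C₀ C₁) (l : ℝ) :
    l / C₁ + 1 / (m * C₀) * (1 - Real.exp (-l)) ≤ potential m C₀ C₁ l := by
  have hm := hw.m_pos
  have hC₀ := hw.C₀_pos
  have hC₁ := hw.C₁_pos
  unfold potential
  split_ifs with h
  · have h1 : 1 - Real.exp (-l) ≤ l := by
      have := Real.add_one_le_exp (-l); linarith
    have h2 : 1 / (m * C₀) * (1 - Real.exp (-l)) ≤ 1 / (m * C₀) * l :=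
      mul_le_mul_of_nonneg_left h1 (by positivity)
    have h3 : l / C₁ ≤ 0 := div_nonpos_of_nonpos_of_nonneg h hC₁.le
    have h4 : 1 / C₀ ≤ 1 / (m * C₀) := by
      apply one_div_le_one_div_of_le (by positivity)
      nlinarith [hw.m_le_one]
    have h5 : 1 / (m * C₀) * l ≤ 1 / C₀ * l := mul_le_mul_of_nonpos_right h4 h
    have h6 : l / C₀ = 1 / C₀ * l := by ring
    linarith
  · exact le_rfl

lemma potential_le (hw : IsUniformChannel w m C₀ C₁) {l B : ℝ} (hB : 0 ≤ B) (hl : l ≤ B) :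
    potential m C₀ C₁ l ≤ B / C₁ + 1 / (m * C₀) := by
  have hm := hw.m_pos
  have hC₀ := hw.C₀_pos
  have hC₁ := hw.C₁_pos
  have h0 : 0 ≤ B / C₁ := by positivity
  have h1 : 0 < 1 / (m * C₀) := by positivity
  unfold potential
  split_ifs with h
  · have := div_nonpos_of_nonpos_of_nonneg h hC₀.le
    linarith
  · have h2 : l / C₁ ≤ B / C₁ := by gcongr
    have h3 : 1 / (m * C₀) * (1 - Real.exp (-l)) ≤ 1 / (m * C₀) * 1 :=
      mul_le_mul_of_nonneg_left (by linarith [Real.exp_pos (-l)]) h1.le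
    linarith

lemma mix_pos (hw : IsUniformChannel w m C₀ C₁) {α : ℝ} (h0 : 0 ≤ α) (h1 : α ≤ 1)
    (x x' : Fin 2) (y : 𝒴) : m ≤ α * w x y + (1 - α) * w x' y := by
  have := hw.m_le x y
  have := hw.m_le x' y
  nlinarith

lemma log_div_mix_le (hw : IsUniformChannel w m C₀ C₁) {α : ℝ} (h0 : 0 ≤ α) (h1 : α ≤ 1)
    (x x' : Fin 2) (y : 𝒴) :
    Real.log (w x y / (α * w x y + (1 - α) * w x' y)) ≤ -Real.log m := by
  have hm := hw.mix_pos h0 h1 x x' y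
  rw [Real.log_div (hw.w_pos x y).ne' (hw.m_pos.trans_le hm).ne']
  have := Real.log_le_log hw.m_pos hm
  have := Real.log_nonpos (hw.w_pos x y).le (hw.w_le_one x y)
  linarith

/-- Slope `1 / C₀` turns a mean increment of at least `C₀` into a drift of at least one;
`div_le_potential` covers the outputs that lift `l` above zero. -/
lemma potential_add_one_le_of_nonpos (hw : IsUniformChannel w m C₀ C₁) {l α : ℝ} (hl : l ≤ 0)
    (h0 : 0 ≤ α) (h1 : α ≤ 1 / 2) {x x' : Fin 2} (hx : x ≠ x') :
    potential m C₀ C₁ l + 1 ≤ ∑ y, w x y *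
      potential m C₀ C₁ (l + Real.log (w x y / (α * w x y + (1 - α) * w x' y))) := by
  have hC₀ := hw.C₀_pos
  have hd := hw.le_div x x' hx α h0 h1
  set Z : 𝒴 → ℝ := fun y => Real.log (w x y / (α * w x y + (1 - α) * w x' y)) with hZ
  calc potential m C₀ C₁ l + 1 = l / C₀ + C₀ / C₀ := by
        rw [potential, if_pos hl, div_self hC₀.ne']
    _ ≤ l / C₀ + (∑ y, w x y * Z y) / C₀ := by gcongr
    _ = ∑ y, w x y * ((l + Z y) / C₀) := by
        rw [← mul_one (l / C₀), ← hw.sum_eq x, Finset.mul_sum, Finset.sum_div,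
          ← Finset.sum_add_distrib]
        exact Finset.sum_congr rfl fun y _ => by ring
    _ ≤ _ := by
        refine Finset.sum_le_sum fun y _ => mul_le_mul_of_nonneg_left ?_ (hw.w_pos x y).le
        refine hw.div_le_potential ?_
        have := hw.log_div_mix_le h0 (by linarith) x x' y
        simp only [hZ]; linarith

/-- The likelihood ratio weighted by `w 0` sums to the total mass of `w 1`, so the mean of `exp
(-l)` is unchanged. Only the linear term drifts, by `C₁ / C₁`. -/
lemma potential_add_one_le_of_pos (hw : IsUniformChannel w m C₀ C₁) {l : ℝ} (hl : 0 < l) :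
    potential m C₀ C₁ l + 1 ≤
      ∑ y, w 0 y * potential m C₀ C₁ (l + Real.log (w 0 y / w 1 y)) := by
  have hC₁ := hw.C₁_pos
  set c := 1 / (m * C₀) with hc
  have hterm (y : 𝒴) : w 0 y * ((l + Real.log (w 0 y / w 1 y)) / C₁ +
      c * (1 - Real.exp (-(l + Real.log (w 0 y / w 1 y))))) =
      w 0 y * (l / C₁ + c) + w 0 y * Real.log (w 0 y / w 1 y) / C₁ -
        w 1 y * (c * Real.exp (-l)) := by
    have h0 := hw.w_pos 0 y
    have h1 := hw.w_pos 1 y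
    have : Real.exp (-(l + Real.log (w 0 y / w 1 y))) = Real.exp (-l) * (w 1 y / w 0 y) := by
      rw [neg_add, Real.exp_add, ← Real.log_inv, Real.exp_log (by positivity), inv_div]
    rw [this]; field_simp; ring
  calc potential m C₀ C₁ l + 1 = (l / C₁ + c) + C₁ / C₁ - c * Real.exp (-l) := by
        rw [potential, if_neg hl.not_ge, div_self hC₁.ne']; ring
    _ = ∑ y, w 0 y * ((l + Real.log (w 0 y / w 1 y)) / C₁ +
          c * (1 - Real.exp (-(l + Real.log (w 0 y / w 1 y))))) := by
        simp only [hterm]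
        rw [Finset.sum_sub_distrib, Finset.sum_add_distrib, ← Finset.sum_mul, ← Finset.sum_mul,
          ← Finset.sum_div, hw.sum_eq, hw.sum_eq, hw.div_eq, one_mul, one_mul]
    _ ≤ _ := Finset.sum_le_sum fun y _ =>
        mul_le_mul_of_nonneg_left (hw.le_potential _) (hw.w_pos 0 y).le

end IsUniformChannel

end Potential

/-! ### Partitions with small enough difference -/

section Partition

variable {M : Type*} [Fintype M]

/-- The mass of the group `x` of the partition `g`. -/
def partMass (q : M → ℝ) (g : M → Fin 2) (x : Fin 2) : ℝ := ∑ s, if g s = x then q s else 0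

/-- Group `0` is at least as heavy as group `1`, but by no more than any of its messages. -/
def IsSEDPartition (q : M → ℝ) (g : M → Fin 2) : Prop :=
  partMass q g 1 ≤ partMass q g 0 ∧
    ∀ s, g s = 0 → 0 < q s → partMass q g 0 - partMass q g 1 ≤ q s

lemma partMass_swap (q : M → ℝ) (g : M → Fin 2) (x : Fin 2) :
    partMass q (fun s => 1 - g s) x = partMass q g (1 - x) := by
  unfold partMass
  refine Finset.sum_congr rfl fun s _ => if_congr ?_ rfl rfl
  change 1 - g s = x ↔ g s = 1 - x
  generalize g s = a
  revert a x; decide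

lemma partMass_update [DecidableEq M] (q : M → ℝ) (g : M → Fin 2) (s : M) (hs : g s = 0) :
    partMass q (Function.update g s 1) 0 - partMass q (Function.update g s 1) 1 =
      partMass q g 0 - partMass q g 1 - 2 * q s := by
  unfold partMass
  rw [← Finset.sum_sub_distrib, ← Finset.sum_sub_distrib, ← Finset.add_sum_erase _ _
    (Finset.mem_univ s), ← Finset.add_sum_erase _ (fun j => (if g j = 0 then q j else 0) -
      if g j = 1 then q j else 0) (Finset.mem_univ s)]
  have : ∀ j ∈ Finset.univ.erase s,
      ((if Function.update g s 1 j = 0 then q j else 0) -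
        if Function.update g s 1 j = 1 then q j else 0) =
      (if g j = 0 then q j else 0) - if g j = 1 then q j else 0 := by
    intro j hj
    rw [Function.update_of_ne (Finset.ne_of_mem_erase hj)]
  rw [Finset.sum_congr rfl this]
  simp [hs]
  ring

/-- Take a partition with the least absolute mass difference, with labels swapped if necessary. A
message of group `0` with positive mass below the difference could be moved to group `1`, making the
difference smaller. -/
lemma exists_isSEDPartition (q : M → ℝ) : ∃ g, IsSEDPartition q g := by
  classical
  obtain ⟨g₀, -, hg₀⟩ := Finset.exists_min_image (Finset.univ : Finset (M → Fin 2))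
    (fun g => |partMass q g 0 - partMass q g 1|) Finset.univ_nonempty
  obtain ⟨g, hg, hle⟩ : ∃ g, (∀ g', |partMass q g 0 - partMass q g 1| ≤
      |partMass q g' 0 - partMass q g' 1|) ∧ partMass q g 1 ≤ partMass q g 0 := by
    rcases le_total (partMass q g₀ 1) (partMass q g₀ 0) with h | h
    · exact ⟨g₀, fun g' => hg₀ g' (Finset.mem_univ _), h⟩
    · refine ⟨fun s => 1 - g₀ s, fun g' => ?_, ?_⟩
      · rw [partMass_swap, partMass_swap, sub_self, sub_zero, abs_sub_comm]
        exact hg₀ g' (Finset.mem_univ _)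
      · rw [partMass_swap, partMass_swap, sub_self, sub_zero]
        exact h
  refine ⟨g, hle, fun s hs hq => ?_⟩
  by_contra! hlt
  have := hg (Function.update g s 1)
  rw [partMass_update q g s hs, abs_of_nonneg (by linarith)] at this
  rcases abs_cases (partMass q g 0 - partMass q g 1 - 2 * q s) with ⟨h, -⟩ | ⟨h, -⟩ <;> linarith

/-- A partition of the messages into two groups whose masses are as equal as in
`IsSEDPartition`. -/
noncomputable def sedPartition (q : M → ℝ) : M → Fin 2 := (exists_isSEDPartition q).choose

lemma isSEDPartition_sedPartition (q : M → ℝ) : IsSEDPartition q (sedPartition q) :=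
  (exists_isSEDPartition q).choose_spec

end Partition

/-! ### The drift of the average potential -/

section Drift

variable {𝒴 M : Type*} [Fintype 𝒴] [Fintype M] {w : Fin 2 → 𝒴 → ℝ} {m C₀ C₁ : ℝ}

/-- The log-likelihood ratio of the message `s` for the unnormalized weights `q`. -/
noncomputable def logRatio (q : M → ℝ) (s : M) : ℝ := Real.log (q s / (∑ j, q j - q s))

lemma partMass_add (q : M → ℝ) (g : M → Fin 2) :
    partMass q g 0 + partMass q g 1 = ∑ s, q s := by
  unfold partMass
  rw [← Finset.sum_add_distrib]
  refine Finset.sum_congr rfl fun s _ => ?_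
  generalize g s = a
  fin_cases a <;> simp

lemma sum_mul_eq_partMass (q : M → ℝ) (g : M → Fin 2) (v : Fin 2 → ℝ) :
    ∑ s, q s * v (g s) = partMass q g 0 * v 0 + partMass q g 1 * v 1 := by
  unfold partMass
  rw [Finset.sum_mul, Finset.sum_mul, ← Finset.sum_add_distrib]
  refine Finset.sum_congr rfl fun s _ => ?_
  generalize g s = a
  fin_cases a <;> simp

lemma le_partMass {q : M → ℝ} (hq : ∀ s, 0 ≤ q s) (g : M → Fin 2) (s : M) :
    q s ≤ partMass q g (g s) := by
  have := Finset.single_le_sum (f := fun j => if g j = g s then q j else 0)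
    (fun j _ => by split_ifs <;> simp [hq]) (Finset.mem_univ s)
  simpa [partMass] using this

lemma add_le_partMass {q : M → ℝ} (hq : ∀ s, 0 ≤ q s) (g : M → Fin 2) {s j : M} (hsj : s ≠ j)
    (h : g s = g j) : q s + q j ≤ partMass q g (g s) := by
  classical
  have := Finset.sum_le_sum_of_subset_of_nonneg (f := fun j => if g j = g s then q j else 0)
    (Finset.subset_univ {s, j}) (fun j _ _ => by split_ifs <;> simp [hq])
  rw [Finset.sum_pair hsj] at this
  simpa [partMass, h] using this

/-- The weight of the own group among the other messages is at most a half. -/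
lemma IsSEDPartition.partMass_sub_le {q : M → ℝ} {g : M → Fin 2} (hg : IsSEDPartition q g)
    {s : M} (hs : 0 < q s) : partMass q g (g s) - q s ≤ partMass q g (1 - g s) := by
  have h1 := hg.1
  have h2 := hg.2 s
  generalize g s = a at *
  fin_cases a
  · have := h2 rfl hs
    simp at this ⊢; linarith
  · simp at h1 ⊢; linarith

/-- A message that is more likely than all others together is alone in group `0`. -/
lemma IsSEDPartition.eq_of_lt {q : M → ℝ} (hq : ∀ s, 0 ≤ q s) {g : M → Fin 2}
    (hg : IsSEDPartition q g) {s : M} (hs : ∑ j, q j - q s < q s) :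
    g s = 0 ∧ partMass q g 0 = q s := by
  have hadd := partMass_add q g
  have h0 : g s = 0 := by
    by_contra h
    have h : g s = 1 := by revert h; generalize g s = a; revert a; decide
    have := le_partMass hq g s
    rw [h] at this
    linarith [hg.1]
  refine ⟨h0, ?_⟩
  -- A further message `j` of positive mass in group `0` would force group `1` to weigh at least `q
  -- s`, whereas all messages other than `s` together weigh less.
  have hz : ∀ j ≠ s, g j = 0 → q j = 0 := by
    intro j hj hgj
    by_contra hne
    have hpos : 0 < q j := lt_of_le_of_ne (hq j) (Ne.symm hne)
    have h1 := hg.2 j hgj hpos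
    have h2 := add_le_partMass hq g hj.symm (h0.trans hgj.symm)
    rw [h0] at h2
    linarith
  rw [partMass, Finset.sum_eq_single s]
  · simp [h0]
  · intro j _ hj
    split_ifs with h
    · exact hz j hj h
    · rfl
  · simp

lemma sum_mul_sub_eq (q : M → ℝ) (g : M → Fin 2) (s : M) (v : Fin 2 → ℝ) :
    ∑ j, q j * v (g j) - q s * v (g s) =
      (partMass q g (g s) - q s) * v (g s) + partMass q g (1 - g s) * v (1 - g s) := by
  rw [sum_mul_eq_partMass]
  generalize g s = a
  fin_cases a <;> simp <;> ring

/-- One step of the drift, for a single message. -/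
lemma potential_logRatio_drift (hw : IsUniformChannel w m C₀ C₁) {q : M → ℝ} (hq : ∀ s, 0 ≤ q s)
    {g : M → Fin 2} (hg : IsSEDPartition q g) {s : M} (hs : 0 < q s) (hs' : q s < ∑ j, q j) :
    potential m C₀ C₁ (logRatio q s) + 1 ≤ ∑ y, w (g s) y *
      potential m C₀ C₁ (logRatio (fun j => q j * w (g j) y) s) := by
  set r := ∑ j, q j - q s with hr
  have hr0 : 0 < r := by linarith
  have hadd : partMass q g (g s) - q s + partMass q g (1 - g s) = r := by
    have := sum_mul_sub_eq q g s (fun _ => 1)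
    simp only [mul_one] at this
    linarith
  -- `α` is the share of the own group in the mass `r` of the competing messages. Conditioned on
  -- those, the output law is the `α`-mixture of the two channel laws, and it is the denominator of
  -- the updated likelihood ratio.
  set α := (partMass q g (g s) - q s) / r with hα
  have hα0 : 0 ≤ α := div_nonneg (by linarith [le_partMass hq g s]) hr0.le
  have hα1 : α ≤ 1 / 2 := by
    rw [hα, div_le_iff₀ hr0]
    have := hg.partMass_sub_le hs
    linarith
  have hratio (y : 𝒴) : logRatio (fun j => q j * w (g j) y) s =
      logRatio q s +
        Real.log (w (g s) y / (α * w (g s) y + (1 - α) * w (1 - g s) y)) := by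
    have hmix := hw.mix_pos hα0 (by linarith) (g s) (1 - g s) y
    have hden : ∑ j, q j * w (g j) y - q s * w (g s) y =
        r * (α * w (g s) y + (1 - α) * w (1 - g s) y) := by
      rw [sum_mul_sub_eq q g s (fun x => w x y), hα]
      field_simp
      rw [← hadd]; ring
    have hwp := hw.w_pos (g s) y
    have hmp : 0 < α * w (g s) y + (1 - α) * w (1 - g s) y := hw.m_pos.trans_le hmix
    unfold logRatio
    rw [hden, ← hr, ← Real.log_mul (by positivity) (by positivity)]
    congr 1
    field_simp
  simp only [hratio]
  rcases le_or_gt (logRatio q s) 0 with hl | hl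
  · refine hw.potential_add_one_le_of_nonpos hl hα0 hα1 ?_
    generalize g s = a
    revert a; decide
  -- Here `s` outweighs its competitors, so it is alone in its group up to null messages and `α =
  -- 0`.
  · have hlt : r < q s := by
      unfold logRatio at hl
      rw [← hr] at hl
      by_contra! h
      exact hl.not_ge (Real.log_nonpos (by positivity) (div_le_one_of_le₀ h hr0.le))
    obtain ⟨h0, h1⟩ := hg.eq_of_lt hq hlt
    have hαz : α = 0 := by rw [hα, h0, h1, sub_self, zero_div]
    rw [hαz, h0]
    simpa using hw.potential_add_one_le_of_pos hl

/-- The average potential of the messages, for the unnormalized weights `q`. -/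
noncomputable def avgPotential (m C₀ C₁ : ℝ) (q : M → ℝ) : ℝ :=
  ∑ s, q s * potential m C₀ C₁ (logRatio q s)

/-- The average potential grows by at least one per channel use. -/
lemma avgPotential_drift (hw : IsUniformChannel w m C₀ C₁) {q : M → ℝ} (hq : ∀ s, 0 ≤ q s)
    {g : M → Fin 2} (hg : IsSEDPartition q g) (hq' : ∀ s, q s < ∑ j, q j) :
    avgPotential m C₀ C₁ q + ∑ s, q s ≤
      ∑ y, avgPotential m C₀ C₁ fun j => q j * w (g j) y := by
  unfold avgPotential
  rw [Finset.sum_comm, ← Finset.sum_add_distrib]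
  refine Finset.sum_le_sum fun s _ => ?_
  rcases (hq s).eq_or_lt with h | h
  · simp [← h]
  · have := mul_le_mul_of_nonneg_left (potential_logRatio_drift hw hq hg h (hq' s)) (hq s)
    rw [Finset.mul_sum] at this
    simp only [mul_assoc]
    linarith

/-- One channel use increases the log-likelihood ratios by at most `-log m`. -/
lemma logRatio_le (hw : IsUniformChannel w m C₀ C₁) {q : M → ℝ} (hq : ∀ s, 0 ≤ q s)
    (g : M → Fin 2) {s : M} (hs : 0 < q s) (hs' : q s < ∑ j, q j) (y : 𝒴) :
    logRatio (fun j => q j * w (g j) y) s ≤ logRatio q s - Real.log m := by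
  classical
  have hr0 : 0 < ∑ j, q j - q s := by linarith
  have hwp := hw.w_pos (g s) y
  have hden : (∑ j, q j - q s) * m ≤ ∑ j, q j * w (g j) y - q s * w (g s) y := by
    rw [← Finset.add_sum_erase _ _ (Finset.mem_univ s), ← Finset.add_sum_erase _
      (fun j => q j * w (g j) y) (Finset.mem_univ s), add_sub_cancel_left, add_sub_cancel_left,
      Finset.sum_mul]
    exact Finset.sum_le_sum fun j _ => mul_le_mul_of_nonneg_left (hw.m_le _ _) (hq j)
  have hm := hw.m_pos
  have hpos : 0 < (∑ j, q j - q s) * m := by positivity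
  unfold logRatio
  rw [← Real.log_div (by positivity) hm.ne']
  refine Real.log_le_log (div_pos (by positivity) (hpos.trans_le hden)) ?_
  rw [div_div]
  refine div_le_div₀ hs.le ?_ hpos hden
  exact mul_le_of_le_one_right hs.le (hw.w_le_one _ _)

end Drift

/-! ### Arrival paths -/

section Arrival

variable {A : BitArrival} {n : ℕ} {b : ℕ → List Bool}

/-- Every step of the path `b` has positive probability under the arrival distribution. -/
def BitArrival.IsPossible (A : BitArrival) (b : ℕ → List Bool) : Prop :=
  ∀ t, bitsAt b (t + 1) ∈ (A.trans t (bitsAt b t)).support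

namespace BitArrival.IsPossible

lemma step (hb : A.IsPossible b) (t : ℕ) :
    bitsAt b (t + 1) = bitsAt b t ∨ bitsAt b (t + 1) = bitsAt b t ++ [false] ∨
      bitsAt b (t + 1) = bitsAt b t ++ [true] := by
  simpa using A.support_subset _ _ (hb t)

lemma length_succ_le (hb : A.IsPossible b) (t : ℕ) :
    (bitsAt b (t + 1)).length ≤ (bitsAt b t).length + 1 := by
  rcases hb.step t with h | h | h <;> simp [h]

lemma length_le_time (hb : A.IsPossible b) (t : ℕ) : (bitsAt b t).length ≤ t := by
  induction t with
  | zero => simp [bitsAt]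
  | succ t ih => have := hb.length_succ_le t; omega

variable (h_length : ∀ t ≥ n, ∀ s : List Bool, s.length = n → A.trans t s s = 1)
include h_length

lemma eq_of_length (hb : A.IsPossible b) {t t' : ℕ} (htt' : t ≤ t')
    (h : (bitsAt b t).length = n) : bitsAt b t' = bitsAt b t := by
  induction t', htt' using Nat.le_induction with
  | base => rfl
  | succ k hk ih =>
    have hl : (bitsAt b k).length = n := by rw [ih, h]
    -- The absorption hypothesis covers only times at least `n`; no string of length `n` exists
    -- earlier, since each step adds at most one bit.
    have h1 := h_length k (hl ▸ hb.length_le_time k) _ hl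
    have h2 := hb k
    rw [(PMF.apply_eq_one_iff _ _).1 h1, Set.mem_singleton_iff] at h2
    rw [h2, ih]

lemma length_le (hb : A.IsPossible b) (t : ℕ) : (bitsAt b t).length ≤ n := by
  induction t with
  | zero => simp [bitsAt]
  | succ t ih =>
    rcases ih.eq_or_lt with h | h
    · rw [hb.eq_of_length h_length (Nat.le_succ t) h, h]
    · have := hb.length_succ_le t; omega

/-- The string at the random time `τ_n` is replaced by the string at the fixed time `T`, so that
decoding errors become events about a single coordinate. -/
lemma eq_arrival (hb : A.IsPossible b) {T : ℕ} (hT : arrivalTime n b ≤ T) :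
    (bitsAt b T).length = n ∧ ∃ k : ℕ, arrivalTime n b = k ∧ bitsAt b k = bitsAt b T := by
  have hex : ∃ t, n ≤ (bitsAt b t).length := by
    by_contra! h
    have : arrivalTime n b = ⊤ := by
      simp only [arrivalTime, iInf_eq_top]
      intro t ht
      exact absurd ht (h t).not_ge
    rw [this] at hT
    exact absurd hT (by simp)
  have hk := Nat.find_spec hex
  have heq : arrivalTime n b = (Nat.find hex : ℕ) :=
    le_antisymm (iInf₂_le (Nat.find hex) hk)
      (le_iInf₂ fun t ht => by exact_mod_cast Nat.find_min' hex ht)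
  have hle : Nat.find hex ≤ T := by rw [heq] at hT; exact_mod_cast hT
  have hl : (bitsAt b (Nat.find hex)).length = n := le_antisymm (hb.length_le h_length _) hk
  have := hb.eq_of_length h_length hle hl
  exact ⟨by rw [this, hl], _, heq, this.symm⟩

end BitArrival.IsPossible

lemma lastBits_pathPrefix (b : ℕ → List Bool) (t : ℕ) :
    lastBits t (pathPrefix t b) = bitsAt b t := by
  cases t <;> rfl

lemma arrivalTime_le_iff {n : ℕ} {b : ℕ → List Bool} {T : ℕ} :
    arrivalTime n b ≤ T ↔ ∃ t ≤ T, n ≤ (bitsAt b t).length := by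
  constructor
  · intro h
    by_contra! h'
    have : ((T + 1 : ℕ) : ℕ∞) ≤ arrivalTime n b := le_iInf₂ fun t ht => by
      by_contra! hlt
      have hlt : t < T + 1 := by exact_mod_cast hlt
      exact absurd ht (h' t (by omega)).not_ge
    have := this.trans h
    norm_cast at this
    omega
  · rintro ⟨t, ht, h⟩
    exact (iInf₂_le t h).trans (by exact_mod_cast ht)

end Arrival

/-! ### The joint law of bits and outputs -/

section System

variable {𝒳 𝒴 : Type*} [Fintype 𝒴] [MeasurableSpace 𝒴] [MeasurableSingletonClass 𝒴]

/-- The conditional law of the next received string and channel output. -/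
noncomputable def systemStep (A : BitArrival) (W : 𝒳 → PMF 𝒴) (f : Encoder 𝒳 𝒴) (t : ℕ)
    (h : Fin t → List Bool × 𝒴) : PMF (List Bool × 𝒴) :=
  (A.trans t (lastBits t fun i => (h i).1)).bind fun b =>
    (W (f t b fun i => (h i).2)).map fun y => (b, y)

lemma systemLaw_eq (A : BitArrival) (W : 𝒳 → PMF 𝒴) (f : Encoder 𝒳 𝒴) :
    systemLaw A W f = pathLaw (systemStep A W f) := rfl

instance (A : BitArrival) (W : 𝒳 → PMF 𝒴) (f : Encoder 𝒳 𝒴) :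
    IsProbabilityMeasure (systemLaw A W f) := by
  rw [systemLaw_eq]; infer_instance

instance (A : BitArrival) : IsProbabilityMeasure A.law := by
  unfold BitArrival.law; infer_instance

lemma systemStep_toMeasure (A : BitArrival) (W : 𝒳 → PMF 𝒴) (f : Encoder 𝒳 𝒴) (t : ℕ)
    (h : Fin t → List Bool × 𝒴) (F : Set (List Bool × 𝒴)) :
    (systemStep A W f t h).toMeasure F = ∑' b, A.trans t (lastBits t fun i => (h i).1) b *
      (W (f t b fun i => (h i).2)).toMeasure {y | (b, y) ∈ F} := by
  have hF : MeasurableSet F := F.to_countable.measurableSet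
  rw [systemStep, PMF.toMeasure_bind_apply _ _ _ hF]
  refine tsum_congr fun b => ?_
  rw [PMF.toMeasure_map_apply _ _ _ (by fun_prop) hF]
  rfl

lemma systemStep_fst (A : BitArrival) (W : 𝒳 → PMF 𝒴) (f : Encoder 𝒳 𝒴) (t : ℕ)
    (h : Fin t → List Bool × 𝒴) (b : List Bool) :
    (systemStep A W f t h).toMeasure {e | e.1 = b} =
      A.trans t (lastBits t fun i => (h i).1) b := by
  rw [systemStep_toMeasure, tsum_eq_single b]
  · simp
  · intro b' hb'
    simp [hb']

lemma systemStep_snd (A : BitArrival) (W : 𝒳 → PMF 𝒴) (f : Encoder 𝒳 𝒴) (t : ℕ)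
    (h : Fin t → List Bool × 𝒴) (y : 𝒴)
    (hs : A.trans t (lastBits t fun i => (h i).1) (lastBits t fun i => (h i).1) = 1) :
    (systemStep A W f t h).toMeasure {e | e.2 = y} =
      W (f t (lastBits t fun i => (h i).1) fun i => (h i).2) y := by
  set s := lastBits t fun i => (h i).1
  have h0 : ∀ b ≠ s, A.trans t s b = 0 := fun b hb => by
    rw [PMF.apply_eq_zero_iff, (PMF.apply_eq_one_iff _ _).1 hs]; exact hb
  rw [systemStep_toMeasure, tsum_eq_single s]
  · rw [hs, one_mul]
    exact PMF.toMeasure_apply_singleton _ _ (measurableSet_singleton y)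
  · intro b hb
    rw [h0 b hb, zero_mul]

lemma ae_isPossible (A : BitArrival) (W : 𝒳 → PMF 𝒴) (f : Encoder 𝒳 𝒴) :
    ∀ᵐ ω ∂systemLaw A W f, A.IsPossible (bitPath ω) := by
  filter_upwards [ae_pathLaw_mem_support (systemStep A W f)] with ω hω t
  have h := hω t
  rw [systemStep, PMF.mem_support_bind_iff] at h
  obtain ⟨b, hb, h⟩ := h
  rw [PMF.mem_support_map_iff] at h
  obtain ⟨y, -, h⟩ := h
  have h1 : (ω t).1 = b := by rw [← h]
  change (ω t).1 ∈ _
  rw [h1, ← lastBits_pathPrefix]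
  exact hb

lemma measurable_bitPath {𝒴 : Type*} [MeasurableSpace 𝒴] : Measurable (bitPath (𝒴 := 𝒴)) :=
  measurable_pi_lambda _ fun t => measurable_fst.comp (measurable_pi_apply t)

/-- Summing out the channel output leaves the arrival transition, whatever the past outputs were;
the channel therefore never influences the law of the bits. -/
lemma systemLaw_bitPath_prefix (A : BitArrival) (W : 𝒳 → PMF 𝒴) (f : Encoder 𝒳 𝒴) (t : ℕ)
    (h : Fin t → List Bool) :
    systemLaw A W f {ω | pathPrefix t (bitPath ω) = h} = A.law {b | pathPrefix t b = h} := by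
  induction t with
  | zero =>
    have h0 (g : Fin 0 → List Bool) : g = h := Subsingleton.elim _ _
    simp [h0]
  | succ t ih =>
    have h1 : {ω : ℕ → List Bool × 𝒴 | pathPrefix (t + 1) (bitPath ω) = h} =
        {ω | pathPrefix t ω ∈ {g : Fin t → List Bool × 𝒴 | (fun i => (g i).1) = Fin.init h} ∧
          ω t ∈ {e : List Bool × 𝒴 | e.1 = h (Fin.last t)}} := by
      ext ω
      constructor
      · rintro rfl; exact ⟨rfl, rfl⟩
      · rintro ⟨h1, h2⟩
        ext1 i
        exact Fin.lastCases h2 (fun j => congrFun h1 j) i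
    rw [h1, systemLaw_eq, pathLaw_prefix_mem_of_const _ _ _ _
      (A.trans t (lastBits t (Fin.init h)) (h (Fin.last t)))]
    · rw [BitArrival.law, pathLaw_prefix_succ, ← systemLaw_eq]
      exact congrArg₂ _ (ih (Fin.init h)) rfl
    · rintro g hg -
      rw [systemStep_fst]
      rw [show (fun i => (g i).1) = Fin.init h from hg]

/-- The received strings have the law of the arrival distribution, whatever the encoder. -/
lemma systemLaw_bitPath_prefix_mem (A : BitArrival) (W : 𝒳 → PMF 𝒴) (f : Encoder 𝒳 𝒴) (t : ℕ)
    (S : Set (Fin t → List Bool)) :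
    systemLaw A W f {ω | pathPrefix t (bitPath ω) ∈ S} = A.law {b | pathPrefix t b ∈ S} := by
  have hmeas (S : Set (Fin t → List Bool)) :
      (systemLaw A W f).map bitPath {b | pathPrefix t b ∈ S} =
        systemLaw A W f {ω | pathPrefix t (bitPath ω) ∈ S} := by
    have hm : MeasurableSet {b : ℕ → List Bool | pathPrefix t b ∈ S} :=
      (measurable_pathPrefix t) S.to_countable.measurableSet
    rw [Measure.map_apply measurable_bitPath hm]
    rfl
  rw [← hmeas, measure_pathPrefix_mem, measure_pathPrefix_mem]
  refine tsum_congr fun h => ?_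
  rw [← systemLaw_bitPath_prefix A W f]
  exact hmeas {h.1}

/-- The arrival time of the message has the same almost sure bounds under every encoder. -/
lemma ae_arrivalTime_le {A : BitArrival} (W : 𝒳 → PMF 𝒴) (f : Encoder 𝒳 𝒴) {n T : ℕ}
    (h : ∀ᵐ b ∂A.law, arrivalTime n b ≤ T) :
    ∀ᵐ ω ∂systemLaw A W f, arrivalTime n (bitPath ω) ≤ T := by
  -- A late arrival is an event about the first `T` strings, hence has the same probability in both
  -- laws.
  have key (b : ℕ → List Bool) : ¬ arrivalTime n b ≤ T ↔ pathPrefix T b ∈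
      {g : Fin T → List Bool | ¬ ∃ t, ∃ ht : t ≤ T,
        n ≤ (lastBits t fun i => g (Fin.castLE ht i)).length} := by
    rw [arrivalTime_le_iff]
    refine not_congr (exists_congr fun t => ?_)
    constructor
    · rintro ⟨ht, h⟩
      exact ⟨ht, by rw [← lastBits_pathPrefix] at h; exact h⟩
    · rintro ⟨ht, h⟩
      exact ⟨ht, by rw [← lastBits_pathPrefix]; exact h⟩
  rw [ae_iff] at h ⊢
  simp only [key] at h ⊢
  rwa [systemLaw_bitPath_prefix_mem]

/-- Up to time `T`, the law depends only on the encoding functions up to time `T`. -/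
lemma systemLaw_prefix_mem_congr (A : BitArrival) (W : 𝒳 → PMF 𝒴) {f f' : Encoder 𝒳 𝒴} {T : ℕ}
    (hf : ∀ t < T, f t = f' t) (S : Set (Fin T → List Bool × 𝒴)) :
    systemLaw A W f {ω | pathPrefix T ω ∈ S} = systemLaw A W f' {ω | pathPrefix T ω ∈ S} := by
  rw [measure_pathPrefix_mem, measure_pathPrefix_mem]
  refine tsum_congr fun h => ?_
  rw [systemLaw_eq, systemLaw_eq]
  refine pathLaw_prefix_congr _ _ T (fun t ht => ?_) T le_rfl h.1
  funext h
  simp only [systemStep, hf t ht]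

end System

/-! ### Switching to posterior matching after the last arrival -/

section Switch

variable {𝒴 : Type*} [Fintype 𝒴] [MeasurableSpace 𝒴] [MeasurableSingletonClass 𝒴]

/-- The joint probability of the outputs `y` up to time `t` and the string `s` at time `t`. -/
noncomputable def jointProb (A : BitArrival) (W : Fin 2 → PMF 𝒴) (f : Encoder (Fin 2) 𝒴) {n : ℕ}
    (t : ℕ) (y : Fin t → 𝒴) (s : List.Vector Bool n) : ℝ :=
  (systemLaw A W f).real {ω | bitsAt (bitPath ω) t = s.toList ∧ outputs t ω = y}

/-- The joint probabilities of the outputs up to time `t` and of the message, for the encoder that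
follows `f` up to time `T` and afterwards sends the group index of `sedPartition`. -/
noncomputable def switchWeight (A : BitArrival) (W : Fin 2 → PMF 𝒴) (f : Encoder (Fin 2) 𝒴)
    (n T : ℕ) : (t : ℕ) → (Fin t → 𝒴) → List.Vector Bool n → ℝ
  | 0, y => jointProb A W f 0 y
  | t + 1, y => if t < T then jointProb A W f (t + 1) y else fun s =>
      switchWeight A W f n T t (Fin.init y) s *
        (W (sedPartition (switchWeight A W f n T t (Fin.init y)) s) (y (Fin.last t))).toReal

/-- The encoder that follows `f` up to time `T` and afterwards sends the group index of the
message in a partition with nearly equal posterior group masses. -/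
noncomputable def switchEncoder (A : BitArrival) (W : Fin 2 → PMF 𝒴) (f : Encoder (Fin 2) 𝒴)
    (n T : ℕ) : Encoder (Fin 2) 𝒴 := fun t b y =>
  if t < T then f t b y else
    -- The default input matters only for strings of another length, which have probability zero
    -- here if `T` bounds the arrival time almost surely.
    if h : b.length = n then sedPartition (switchWeight A W f n T t y) ⟨b, h⟩ else 0

variable {A : BitArrival} {W : Fin 2 → PMF 𝒴} {f : Encoder (Fin 2) 𝒴} {n T : ℕ}

lemma switchWeight_of_le {t : ℕ} (ht : t ≤ T) (y : Fin t → 𝒴) :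
    switchWeight A W f n T t y = jointProb A W f t y := by
  cases t with
  | zero => rfl
  | succ t => rw [switchWeight, if_pos (by omega)]

lemma switchWeight_succ {t : ℕ} (ht : T ≤ t) (y : Fin (t + 1) → 𝒴) (s : List.Vector Bool n) :
    switchWeight A W f n T (t + 1) y s = switchWeight A W f n T t (Fin.init y) s *
      (W (sedPartition (switchWeight A W f n T t (Fin.init y)) s) (y (Fin.last t))).toReal := by
  rw [switchWeight, if_neg (by omega)]

lemma switchWeight_nonneg (t : ℕ) (y : Fin t → 𝒴) (s : List.Vector Bool n) :
    0 ≤ switchWeight A W f n T t y s := by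
  induction t with
  | zero => exact measureReal_nonneg
  | succ t ih =>
    by_cases h : t < T
    · rw [switchWeight_of_le (by omega)]; exact measureReal_nonneg
    · rw [switchWeight_succ (by omega)]
      exact mul_nonneg (ih _) ENNReal.toReal_nonneg

lemma measurable_outputs {𝒴 : Type*} [MeasurableSpace 𝒴] (t : ℕ) : Measurable (outputs (𝒴 := 𝒴) t) :=
  measurable_pi_lambda _ fun i => measurable_snd.comp (measurable_pi_apply (i : ℕ))

lemma measurable_bitsAt {𝒴 : Type*} [MeasurableSpace 𝒴] (t : ℕ) :
    Measurable fun ω : ℕ → List Bool × 𝒴 => bitsAt (bitPath ω) t := by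
  cases t with
  | zero => exact measurable_const
  | succ t => exact measurable_fst.comp (measurable_pi_apply t)

/-- `switchWeight` is the joint law of the message and the outputs under `switchEncoder`. -/
lemma systemLaw_switchEncoder_real
    (h_length : ∀ t ≥ n, ∀ s : List Bool, s.length = n → A.trans t s s = 1)
    {t : ℕ} (ht : T ≤ t) (y : Fin t → 𝒴) (s : List.Vector Bool n) :
    (systemLaw A W (switchEncoder A W f n T)).real
      {ω | bitsAt (bitPath ω) T = s.toList ∧ outputs t ω = y} =
      switchWeight A W f n T t y s := by
  -- The encoder needs the posterior, which depends on the encoder. The circle is broken by defining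
  -- the weights through their own recursion after `T`; this induction identifies them with the
  -- actual joint law.
  induction t, ht using Nat.le_induction with
  | base =>
    rw [switchWeight_of_le le_rfl, jointProb, measureReal_def, measureReal_def]
    refine congrArg ENNReal.toReal ?_
    have : {ω : ℕ → List Bool × 𝒴 | bitsAt (bitPath ω) T = s.toList ∧ outputs T ω = y} =
        {ω | pathPrefix T ω ∈ {h : Fin T → List Bool × 𝒴 |
          lastBits T (fun i => (h i).1) = s.toList ∧ (fun i => (h i).2) = y}} := by
      ext ω
      change _ ↔ lastBits T (pathPrefix T (bitPath ω)) = s.toList ∧ _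
      rw [lastBits_pathPrefix]
      rfl
    rw [this]
    refine systemLaw_prefix_mem_congr A W (fun t ht => ?_) _
    funext b y
    simp [switchEncoder, ht]
  | succ t ht ih =>
    set μ := systemLaw A W (switchEncoder A W f n T) with hμ
    rw [switchWeight_succ ht, ← ih, measureReal_def, measureReal_def, ← ENNReal.toReal_mul]
    refine congrArg ENNReal.toReal ?_
    set S : Set (Fin t → List Bool × 𝒴) := {h | lastBits T (fun i => (h (Fin.castLE ht i)).1) =
      s.toList ∧ (fun i => (h i).2) = Fin.init y} with hS
    have e1 : {ω : ℕ → List Bool × 𝒴 | bitsAt (bitPath ω) T = s.toList ∧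
        outputs (t + 1) ω = y} = {ω | pathPrefix t ω ∈ S ∧ ω t ∈ {e | e.2 = y (Fin.last t)}} := by
      ext ω
      change _ ↔ (lastBits T (pathPrefix T (bitPath ω)) = s.toList ∧ outputs t ω = Fin.init y) ∧
        (ω t).2 = y (Fin.last t)
      rw [lastBits_pathPrefix]
      change _ ∧ _ ↔ _
      rw [and_assoc]
      refine and_congr_right fun _ => ?_
      constructor
      · rintro rfl; exact ⟨rfl, rfl⟩
      · rintro ⟨h1, h2⟩
        ext1 i
        exact Fin.lastCases h2 (fun j => congrFun h1 j) i
    have e2 : {ω : ℕ → List Bool × 𝒴 | bitsAt (bitPath ω) T = s.toList ∧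
        outputs t ω = Fin.init y} = {ω | pathPrefix t ω ∈ S} := by
      ext ω
      change _ ↔ lastBits T (pathPrefix T (bitPath ω)) = s.toList ∧ outputs t ω = Fin.init y
      rw [lastBits_pathPrefix]
      rfl
    rw [e1, e2, hμ, systemLaw_eq]
    refine pathLaw_prefix_mem_of_const _ _ _ _ _ fun h hh h0 => ?_
    -- A past of positive probability is realized by a possible path, along which the message is
    -- complete at `T` and hence frozen; this determines the channel input at the next step.
    obtain ⟨ω, hωh, hω⟩ : ∃ ω, pathPrefix t ω = h ∧ A.IsPossible (bitPath ω) := by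
      by_contra! hne
      refine h0 (measure_mono_null (fun ω hω => ?_)
        (ae_iff.1 (ae_isPossible A W (switchEncoder A W f n T))))
      exact hne ω hω
    have hT : bitsAt (bitPath ω) T = s.toList := by
      rw [← lastBits_pathPrefix, ← hh.1, ← hωh]; rfl
    have hl : (bitsAt (bitPath ω) T).length = n := by rw [hT, s.toList_length]
    have hlast : (lastBits t fun i => (h i).1) = s.toList := by
      rw [← hT, ← hω.eq_of_length h_length ht hl, ← lastBits_pathPrefix, ← hωh]; rfl
    have hnt : n ≤ t := by
      rw [← hl]; exact (hω.length_le_time T).trans ht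
    rw [systemStep_snd _ _ _ _ _ _ (by
      rw [hlast]; exact h_length t hnt _ s.toList_length), hlast, hh.2]
    rw [switchEncoder, if_neg (by omega), dif_pos s.toList_length]
    rfl

/-- Joint events of the message and the outputs. -/
lemma systemLaw_switchEncoder_event
    (h_length : ∀ t ≥ n, ∀ s : List Bool, s.length = n → A.trans t s s = 1)
    {t : ℕ} (ht : T ≤ t) (R : Set ((Fin t → 𝒴) × List.Vector Bool n)) [DecidablePred (· ∈ R)] :
    (systemLaw A W (switchEncoder A W f n T)).real
      {ω | ∃ s : List.Vector Bool n, bitsAt (bitPath ω) T = s.toList ∧ (outputs t ω, s) ∈ R} =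
      ∑ y, ∑ s, if (y, s) ∈ R then switchWeight A W f n T t y s else 0 := by
  have : {ω : ℕ → List Bool × 𝒴 | ∃ s : List.Vector Bool n,
      bitsAt (bitPath ω) T = s.toList ∧ (outputs t ω, s) ∈ R} =
      ⋃ p ∈ Finset.univ.filter (· ∈ R),
        {ω | bitsAt (bitPath ω) T = p.2.toList ∧ outputs t ω = p.1} := by
    ext ω
    simp only [Set.mem_iUnion, Finset.mem_filter, Finset.mem_univ, true_and]
    constructor
    · rintro ⟨s, h1, h2⟩
      exact ⟨(outputs t ω, s), h2, h1, rfl⟩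
    · rintro ⟨⟨y, s⟩, h1, h2, rfl⟩
      exact ⟨s, h2, h1⟩
  rw [this, measureReal_biUnion_finset, Finset.sum_filter, Fintype.sum_prod_type]
  · refine Finset.sum_congr rfl fun y _ => Finset.sum_congr rfl fun s _ => ?_
    simp only [systemLaw_switchEncoder_real h_length ht]
  · intro p _ q _ hpq
    refine Set.disjoint_left.2 ?_
    rintro ω ⟨h1, h2⟩ ⟨h3, h4⟩
    refine hpq (Prod.ext (h2.symm.trans h4) ?_)
    exact Subtype.ext (h1.symm.trans h3)
  · intro p _
    exact ((measurable_bitsAt T) (measurableSet_singleton _)).inter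
      ((measurable_outputs t) (measurableSet_singleton _))

end Switch

/-! ### Stopping at the first success of a test of the outputs -/

section Hitting

variable {𝒴 : Type*} [Fintype 𝒴] [MeasurableSpace 𝒴] [MeasurableSingletonClass 𝒴]

/-- The first time at which the outputs pass the test `p`. -/
noncomputable def firstPass (p : (t : ℕ) → (Fin t → 𝒴) → Prop) (ω : ℕ → List Bool × 𝒴) : ℕ∞ :=
  ⨅ (t : ℕ) (_ : p t (outputs t ω)), (t : ℕ∞)

/-- No initial segment of `y` passes the test. -/
def NoPass (p : (t : ℕ) → (Fin t → 𝒴) → Prop) (t : ℕ) (y : Fin t → 𝒴) : Prop :=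
  ∀ t' (h : t' ≤ t), ¬ p t' fun i => y (Fin.castLE h i)

variable {p : (t : ℕ) → (Fin t → 𝒴) → Prop} {ω : ℕ → List Bool × 𝒴} {t : ℕ}

omit [Fintype 𝒴] [MeasurableSpace 𝒴] [MeasurableSingletonClass 𝒴]

lemma NoPass.not_pass {y : Fin t → 𝒴} (h : NoPass p t y) : ¬ p t y := h t le_rfl

lemma NoPass.init {y : Fin (t + 1) → 𝒴} (h : NoPass p (t + 1) y) : NoPass p t (Fin.init y) :=
  fun t' ht' => h t' (ht'.trans (Nat.le_succ t))

lemma firstPass_le_iff : firstPass p ω ≤ t ↔ ∃ t' ≤ t, p t' (outputs t' ω) := by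
  constructor
  · intro h
    by_contra! h'
    have : ((t + 1 : ℕ) : ℕ∞) ≤ firstPass p ω := le_iInf₂ fun k hk => by
      by_contra! hlt
      have hlt : k < t + 1 := by exact_mod_cast hlt
      exact h' k (by omega) hk
    have := this.trans h
    norm_cast at this
    omega
  · rintro ⟨k, hk, h⟩
    exact (iInf₂_le k h).trans (by exact_mod_cast hk)

lemma lt_firstPass_iff : (t : ℕ∞) < firstPass p ω ↔ NoPass p t (outputs t ω) := by
  rw [← not_le, firstPass_le_iff]
  push Not
  rfl

lemma firstPass_eq_iff : firstPass p ω = t ↔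
    p t (outputs t ω) ∧ ∀ t' (h : t' < t), ¬ p t' fun i => outputs t ω (Fin.castLE h.le i) := by
  constructor
  · intro h
    have hlt : ∀ t' < t, ¬ p t' (outputs t' ω) := by
      intro t' ht' hp
      have := firstPass_le_iff.2 ⟨t', le_rfl, hp⟩
      rw [h] at this
      norm_cast at this
      omega
    obtain ⟨k, hk, hp⟩ := firstPass_le_iff.1 h.le
    rcases hk.eq_or_lt with rfl | hk
    · exact ⟨hp, fun t' ht' => hlt t' ht'⟩
    · exact absurd hp (hlt k hk)
  · rintro ⟨h1, h2⟩
    refine le_antisymm (firstPass_le_iff.2 ⟨t, le_rfl, h1⟩) ?_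
    by_contra! hlt
    obtain ⟨k, hk⟩ := ENat.ne_top_iff_exists.1 (hlt.trans_le le_top).ne
    rw [← hk] at hlt
    have hkt : k < t := by exact_mod_cast hlt
    obtain ⟨j, hj, hp⟩ := firstPass_le_iff.1 hk.ge
    exact h2 j (by omega) hp

/-- Pointwise form of the tail-sum formula for the mean of a stopping time. -/
lemma toENNReal_eq_tsum_lt (k : ℕ∞) :
    (k : ℝ≥0∞) = ∑' t : ℕ, if (t : ℕ∞) < k then 1 else 0 := by
  induction k using ENat.recTopCoe with
  | top => simp
  | coe k =>
    rw [tsum_eq_sum (s := Finset.range k)]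
    · simp only [Nat.cast_lt]
      rw [Finset.sum_ite_of_true fun i hi => Finset.mem_range.1 hi]
      simp
    · intro t ht
      simpa using ht

end Hitting

section Hitting

variable {𝒴 : Type*} [Fintype 𝒴] [MeasurableSpace 𝒴] [MeasurableSingletonClass 𝒴]

lemma isStoppingTime_firstPass (p : (t : ℕ) → (Fin t → 𝒴) → Prop) :
    IsStoppingTime (outputFiltration 𝒴) (firstPass p) := by
  intro t
  refine ⟨{y | ∃ t', ∃ h : t' ≤ t, p t' fun i => y (Fin.castLE h i)},
    (Set.toFinite _).measurableSet, ?_⟩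
  ext ω
  change _ ↔ firstPass p ω ≤ (t : ℕ∞)
  rw [firstPass_le_iff]
  constructor
  · rintro ⟨t', h, hp⟩; exact ⟨t', h, hp⟩
  · rintro ⟨t', h, hp⟩; exact ⟨t', h, hp⟩

lemma measurableSet_outputs_mem (t : ℕ) (S : Set (Fin t → 𝒴)) :
    MeasurableSet {ω | outputs t ω ∈ S} :=
  (measurable_outputs t) (Set.toFinite S).measurableSet

lemma lintegral_firstPass (p : (t : ℕ) → (Fin t → 𝒴) → Prop)
    (μ : Measure (ℕ → List Bool × 𝒴)) :
    ∫⁻ ω, (firstPass p ω : ℝ≥0∞) ∂μ = ∑' t, μ {ω | NoPass p t (outputs t ω)} := by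
  classical
  simp only [toENNReal_eq_tsum_lt, lt_firstPass_iff]
  have hm (t : ℕ) : MeasurableSet {ω : ℕ → List Bool × 𝒴 | NoPass p t (outputs t ω)} :=
    measurableSet_outputs_mem t {y | NoPass p t y}
  have hind (t : ℕ) : (fun ω => if NoPass p t (outputs t ω) then (1 : ℝ≥0∞) else 0) =
      Set.indicator {ω | NoPass p t (outputs t ω)} 1 := by
    ext ω; simp [Set.indicator_apply]
  rw [lintegral_tsum]
  · refine tsum_congr fun t => ?_
    rw [hind, lintegral_indicator_one (hm t)]
  · intro t
    rw [hind]
    exact (measurable_one.indicator (hm t)).aemeasurable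

end Hitting

/-! ### Bounds on the average potential -/

section Deficit

variable {𝒴 M : Type*} [Fintype 𝒴] [Fintype M] {w : Fin 2 → 𝒴 → ℝ} {m C₀ C₁ ε : ℝ}

/-- A bound for the potentials reached before and upon attaining error probability `ε`. -/
noncomputable def potentialBound (m C₀ C₁ ε : ℝ) : ℝ :=
  (-Real.log ε - Real.log m) / C₁ + 1 / (m * C₀)

/-- The competitors hold more than a fraction `ε` of the total mass, hence more than `ε * q s`. -/
lemma logRatio_le_neg_log {q : M → ℝ} (hε : 0 < ε) (hε1 : ε < 1) {s : M} (hs : 0 < q s)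
    (h : q s < (1 - ε) * ∑ j, q j) : logRatio q s ≤ -Real.log ε := by
  have h1 : ε * q s < ε * ∑ j, q j := by
    have : 0 < ∑ j, q j := by
      by_contra! h0
      have : (1 - ε) * ∑ j, q j ≤ 0 := mul_nonpos_of_nonneg_of_nonpos (by linarith) h0
      linarith
    refine mul_lt_mul_of_pos_left ?_ hε
    linarith [mul_pos hε this]
  have h2 : 0 < ∑ j, q j - q s := by nlinarith
  rw [logRatio, ← Real.log_inv]
  refine Real.log_le_log (by positivity) ?_
  rw [inv_eq_one_div, div_le_div_iff₀ h2 hε]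
  nlinarith

lemma lt_sum_of_lt {q : M → ℝ} (hq : ∀ s, 0 ≤ q s) (hε : 0 < ε) {s : M}
    (h : q s < (1 - ε) * ∑ j, q j) : q s < ∑ j, q j := by
  have : 0 ≤ ∑ j, q j := Finset.sum_nonneg fun j _ => hq j
  nlinarith

lemma avgPotential_le (hw : IsUniformChannel w m C₀ C₁) {q : M → ℝ} (hq : ∀ s, 0 ≤ q s)
    {B : ℝ} (hB : 0 ≤ B) (h : ∀ s, 0 < q s → logRatio q s ≤ B) :
    avgPotential m C₀ C₁ q ≤ (B / C₁ + 1 / (m * C₀)) * ∑ s, q s := by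
  rw [avgPotential, Finset.mul_sum]
  refine Finset.sum_le_sum fun s _ => ?_
  rcases (hq s).eq_or_lt with h0 | h0
  · simp [← h0]
  · rw [mul_comm]
    exact mul_le_mul_of_nonneg_right (hw.potential_le hB (h s h0)) (hq s)

lemma avgPotential_le_potentialBound (hw : IsUniformChannel w m C₀ C₁) {q : M → ℝ}
    (hq : ∀ s, 0 ≤ q s) (hε : 0 < ε) (hε1 : ε < 1) (h : ∀ s, q s < (1 - ε) * ∑ j, q j) :
    avgPotential m C₀ C₁ q ≤ potentialBound m C₀ C₁ ε * ∑ s, q s := by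
  have h1 := Real.log_nonpos hε.le hε1.le
  have h2 := Real.log_nonpos hw.m_pos.le hw.m_le_one
  exact avgPotential_le hw hq (by linarith) fun s hs => by
    have := logRatio_le_neg_log hε hε1 hs (h s)
    linarith

/-- The step at which the test succeeds may overshoot, but by at most `-log m`; this is the reason
for that term in `potentialBound`. -/
lemma avgPotential_child_le_potentialBound (hw : IsUniformChannel w m C₀ C₁) {q : M → ℝ}
    (hq : ∀ s, 0 ≤ q s) (hε : 0 < ε) (hε1 : ε < 1) (h : ∀ s, q s < (1 - ε) * ∑ j, q j)
    (g : M → Fin 2) (y : 𝒴) :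
    avgPotential m C₀ C₁ (fun s => q s * w (g s) y) ≤
      potentialBound m C₀ C₁ ε * ∑ s, q s * w (g s) y := by
  have h1 := Real.log_nonpos hε.le hε1.le
  have h2 := Real.log_nonpos hw.m_pos.le hw.m_le_one
  refine avgPotential_le hw (fun s => mul_nonneg (hq s) (hw.w_pos _ _).le) (by linarith)
    fun s hs => ?_
  have hs' : 0 < q s := by
    refine lt_of_le_of_ne (hq s) fun h0 => ?_
    simp [← h0] at hs
  have := logRatio_le_neg_log hε hε1 hs' (h s)
  have := logRatio_le hw hq g hs' (lt_sum_of_lt hq hε (h s)) y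
  linarith

/-- The ratio `p / (1 - p)` is at least the posterior `p`, so the potential is at least `log p /
C₀`, also where it is positive. Averaging turns this into an entropy: the initial deficit costs at
most the conditional entropy over the capacity. -/
lemma neg_avgPotential_le (hw : IsUniformChannel w m C₀ C₁) {q : M → ℝ} (hq : ∀ s, 0 ≤ q s)
    (h : ∀ s, q s < ∑ j, q j) :
    -avgPotential m C₀ C₁ q ≤ (∑ s, q s * Real.log ((∑ j, q j) / q s)) / C₀ := by
  have hC₀ := hw.C₀_pos
  have hC₁ := hw.C₁_pos
  rw [avgPotential, ← Finset.sum_neg_distrib, Finset.sum_div]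
  refine Finset.sum_le_sum fun s _ => ?_
  rcases (hq s).eq_or_lt with h0 | h0
  · simp [← h0]
  have hr : 0 < ∑ j, q j - q s := by linarith [h s]
  have hQ : 0 < ∑ j, q j := by linarith [h s]
  have h1 : -Real.log ((∑ j, q j) / q s) ≤ logRatio q s := by
    rw [← Real.log_inv, inv_div, logRatio]
    exact Real.log_le_log (by positivity)
      (div_le_div_of_nonneg_left h0.le hr (by linarith))
  have h2 : 0 ≤ Real.log ((∑ j, q j) / q s) :=
    Real.log_nonneg (by rw [le_div_iff₀ h0]; linarith [h s])
  have h3 : -(Real.log ((∑ j, q j) / q s) / C₀) ≤ potential m C₀ C₁ (logRatio q s) := by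
    by_cases hl : logRatio q s ≤ 0
    · rw [potential, if_pos hl, ← neg_div]
      gcongr
    · have h4 := hw.le_potential (logRatio q s)
      push Not at hl
      have h5 : 0 ≤ 1 - Real.exp (-logRatio q s) := by
        have := Real.exp_le_one_iff.2 (neg_nonpos.2 hl.le); linarith
      have hm := hw.m_pos
      have : 0 ≤ logRatio q s / C₁ + 1 / (m * C₀) * (1 - Real.exp (-logRatio q s)) := by
        positivity
      have : 0 ≤ Real.log ((∑ j, q j) / q s) / C₀ := by positivity
      linarith
  have := mul_le_mul_of_nonneg_left h3 (hq s)
  rw [mul_div_assoc]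
  linarith

end Deficit

/-! ### The code -/

section Code

variable {𝒴 : Type*} [Fintype 𝒴] [MeasurableSpace 𝒴] [MeasurableSingletonClass 𝒴]

/-- Not before time `T`, some message has posterior probability at least `1 - ε`. -/
def switchTest (A : BitArrival) (W : Fin 2 → PMF 𝒴) (f : Encoder (Fin 2) 𝒴) (n T : ℕ) (ε : ℝ)
    (t : ℕ) (y : Fin t → 𝒴) : Prop :=
  T ≤ t ∧ ∃ s, (1 - ε) * ∑ j, switchWeight A W f n T t y j ≤ switchWeight A W f n T t y s

open Classical in
/-- Decode to a message with posterior probability at least `1 - ε`. -/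
noncomputable def switchDecoder (A : BitArrival) (W : Fin 2 → PMF 𝒴) (f : Encoder (Fin 2) 𝒴)
    (n T : ℕ) (ε : ℝ) (t : ℕ) (y : Fin t → 𝒴) : List.Vector Bool n :=
  if h : switchTest A W f n T ε t y then h.2.choose else List.Vector.replicate n false

variable {A : BitArrival} {W : Fin 2 → PMF 𝒴} {f : Encoder (Fin 2) 𝒴} {n T : ℕ}
  {m C₀ C₁ ε : ℝ}

lemma le_switchWeight_switchDecoder {t : ℕ} {y : Fin t → 𝒴} (h : switchTest A W f n T ε t y) :
    (1 - ε) * ∑ j, switchWeight A W f n T t y j ≤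
      switchWeight A W f n T t y (switchDecoder A W f n T ε t y) := by
  rw [switchDecoder, dif_pos h]
  exact h.2.choose_spec

lemma lt_of_noPass {t : ℕ} (ht : T ≤ t) {y : Fin t → 𝒴}
    (h : NoPass (switchTest A W f n T ε) t y) (s : List.Vector Bool n) :
    switchWeight A W f n T t y s < (1 - ε) * ∑ j, switchWeight A W f n T t y j := by
  by_contra! hs
  exact h.not_pass ⟨ht, s, hs⟩

lemma sum_fin_succ_fun {𝒴 : Type*} [Fintype 𝒴] (t : ℕ) (F : (Fin (t + 1) → 𝒴) → ℝ) :
    ∑ y, F y = ∑ y : Fin t → 𝒴, ∑ z, F (Fin.snoc (α := fun _ => 𝒴) y z) := by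
  rw [← (Fin.snocEquiv fun _ : Fin (t + 1) => 𝒴).sum_comp, Fintype.sum_prod_type_right]
  rfl

open Classical in
/-- The expected distance of the average potential from its bound, before stopping. -/
noncomputable def switchDeficit (A : BitArrival) (W : Fin 2 → PMF 𝒴) (f : Encoder (Fin 2) 𝒴)
    (n T : ℕ) (m C₀ C₁ ε : ℝ) (t : ℕ) : ℝ :=
  ∑ y : Fin t → 𝒴, if NoPass (switchTest A W f n T ε) t y then
    potentialBound m C₀ C₁ ε * ∑ s, switchWeight A W f n T t y s -
      avgPotential m C₀ C₁ (switchWeight A W f n T t y) else 0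

lemma switchDeficit_nonneg (hw : IsUniformChannel (fun x y => (W x y).toReal) m C₀ C₁)
    (hε : 0 < ε) (hε1 : ε < 1) {t : ℕ} (ht : T ≤ t) :
    0 ≤ switchDeficit A W f n T m C₀ C₁ ε t := by
  refine Finset.sum_nonneg fun y _ => ?_
  split_ifs with h
  · have := avgPotential_le_potentialBound hw (switchWeight_nonneg t y) hε hε1 (lt_of_noPass ht h)
    linarith
  · exact le_rfl

open Classical in
-- The drift of the potential pays one unit per channel use, weighted by the probability of not
-- having stopped. Children that pass the test are dropped from the sum, which only lowers it
-- because their deficits are still nonnegative.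
lemma switchDeficit_succ_le (hw : IsUniformChannel (fun x y => (W x y).toReal) m C₀ C₁)
    (hε : 0 < ε) (hε1 : ε < 1) {t : ℕ} (ht : T ≤ t) :
    switchDeficit A W f n T m C₀ C₁ ε (t + 1) +
      (∑ y : Fin t → 𝒴, if NoPass (switchTest A W f n T ε) t y then
        ∑ s, switchWeight A W f n T t y s else 0) ≤
      switchDeficit A W f n T m C₀ C₁ ε t := by
  unfold switchDeficit
  rw [sum_fin_succ_fun, ← Finset.sum_add_distrib]
  refine Finset.sum_le_sum fun y _ => ?_
  set q := switchWeight A W f n T t y with hq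
  have hq0 : ∀ s, 0 ≤ q s := switchWeight_nonneg t y
  have hchild (z : 𝒴) : switchWeight A W f n T (t + 1) (Fin.snoc (α := fun _ => 𝒴) y z) =
      fun s => q s * (W (sedPartition q s) z).toReal := by
    funext s
    rw [switchWeight_succ ht, Fin.init_snoc, Fin.snoc_last]
  by_cases h : NoPass (switchTest A W f n T ε) t y
  · simp only [if_pos h, hchild]
    have hlt := lt_of_noPass ht h
    have h1 : ∀ z : 𝒴, (if NoPass (switchTest A W f n T ε) (t + 1)
        (Fin.snoc (α := fun _ => 𝒴) y z) then
        potentialBound m C₀ C₁ ε * ∑ s, q s * (W (sedPartition q s) z).toReal -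
          avgPotential m C₀ C₁ (fun s => q s * (W (sedPartition q s) z).toReal) else 0) ≤
        potentialBound m C₀ C₁ ε * ∑ s, q s * (W (sedPartition q s) z).toReal -
          avgPotential m C₀ C₁ (fun s => q s * (W (sedPartition q s) z).toReal) := by
      intro z
      have := avgPotential_child_le_potentialBound hw hq0 hε hε1 hlt (sedPartition q) z
      split_ifs
      · exact le_rfl
      · linarith
    have h2 := avgPotential_drift hw hq0 (isSEDPartition_sedPartition q)
      fun s => lt_sum_of_lt hq0 hε (hlt s)
    have h3 : ∑ z, ∑ s, q s * (W (sedPartition q s) z).toReal = ∑ s, q s := by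
      rw [Finset.sum_comm]
      refine Finset.sum_congr rfl fun s _ => ?_
      rw [← Finset.mul_sum, sum_toReal_pmf, mul_one]
    have h4 := Finset.sum_le_sum fun z (_ : z ∈ Finset.univ) => h1 z
    rw [Finset.sum_sub_distrib, ← Finset.mul_sum, h3] at h4
    linarith
  · have h1 : ∀ z : 𝒴, ¬ NoPass (switchTest A W f n T ε) (t + 1)
        (Fin.snoc (α := fun _ => 𝒴) y z) := by
      intro z hz
      have := hz.init
      rw [Fin.init_snoc] at this
      exact h this
    simp [h, h1]

open Classical in
lemma systemLaw_switchEncoder_outputs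
    (h_length : ∀ t ≥ n, ∀ s : List Bool, s.length = n → A.trans t s s = 1)
    (h_arrival : ∀ᵐ b ∂A.law, arrivalTime n b ≤ T) {t : ℕ} (ht : T ≤ t) (S : Set (Fin t → 𝒴)) :
    (systemLaw A W (switchEncoder A W f n T)).real {ω | outputs t ω ∈ S} =
      ∑ y, if y ∈ S then ∑ s, switchWeight A W f n T t y s else 0 := by
  have h := systemLaw_switchEncoder_event (W := W) (f := f) h_length ht
    {p : (Fin t → 𝒴) × List.Vector Bool n | p.1 ∈ S}
  have hae : {ω : ℕ → List Bool × 𝒴 | ∃ s : List.Vector Bool n, bitsAt (bitPath ω) T = s.toList ∧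
      (outputs t ω, s) ∈ {p : (Fin t → 𝒴) × List.Vector Bool n | p.1 ∈ S}} =ᵐ[systemLaw A W
        (switchEncoder A W f n T)] {ω | outputs t ω ∈ S} := by
    filter_upwards [ae_isPossible A W (switchEncoder A W f n T),
      ae_arrivalTime_le W (switchEncoder A W f n T) h_arrival] with ω h1 h2
    have hl := (h1.eq_arrival h_length h2).1
    refine propext ⟨?_, fun h => ⟨⟨_, hl⟩, rfl, h⟩⟩
    rintro ⟨s, -, h⟩
    exact h
  rw [← measureReal_congr hae, h]
  refine Finset.sum_congr rfl fun y _ => ?_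
  by_cases hy : y ∈ S <;> simp [hy]

lemma outputs_eq_sum_jointProb
    (h_length : ∀ t ≥ n, ∀ s : List Bool, s.length = n → A.trans t s s = 1)
    (h_arrival : ∀ᵐ b ∂A.law, arrivalTime n b ≤ T) (y : Fin T → 𝒴) :
    (systemLaw A W f).real (outputs T ⁻¹' {y}) =
      ∑ s : List.Vector Bool n, jointProb A W f T y s := by
  unfold jointProb
  rw [← measureReal_iUnion_fintype]
  · refine measureReal_congr ?_
    filter_upwards [ae_isPossible A W f, ae_arrivalTime_le W f h_arrival] with ω h1 h2
    have hl := (h1.eq_arrival h_length h2).1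
    refine propext ⟨fun h => Set.mem_iUnion.2 ⟨⟨_, hl⟩, rfl, h⟩, fun h => ?_⟩
    obtain ⟨s, -, h⟩ := Set.mem_iUnion.1 h
    exact h
  · intro s s' hs
    refine Set.disjoint_left.2 ?_
    rintro ω ⟨h1, -⟩ ⟨h2, -⟩
    exact hs (Subtype.ext (h1.symm.trans h2))
  · intro s
    exact ((measurable_bitsAt T) (measurableSet_singleton _)).inter
      ((measurable_outputs T) (measurableSet_singleton _))

/-- The conditional entropy of the message given the outputs at time `T`, in nats. -/
lemma condEntropy_mul_log_two
    (h_length : ∀ t ≥ n, ∀ s : List Bool, s.length = n → A.trans t s s = 1)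
    (h_arrival : ∀ᵐ b ∂A.law, arrivalTime n b ≤ T) :
    condEntropy (systemLaw A W f) (fun ω => bitsAt (bitPath ω) T) (outputs T) * Real.log 2 =
      ∑ y, ∑ s : List.Vector Bool n, jointProb A W f T y s *
        Real.log ((∑ j : List.Vector Bool n, jointProb A W f T y j) / jointProb A W f T y s) := by
  have hl2 : Real.log 2 ≠ 0 := (Real.log_pos one_lt_two).ne'
  rw [condEntropy, Finset.sum_mul]
  refine Finset.sum_congr rfl fun y _ => ?_
  set μ := systemLaw A W f with hμ
  set V : Set (ℕ → List Bool × 𝒴) := outputs T ⁻¹' {y} with hV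
  have hVm : MeasurableSet V := (measurable_outputs T) (measurableSet_singleton y)
  have hzero (u : List Bool) (hu : u.length ≠ n) :
      (μ[|V]).real ((fun ω => bitsAt (bitPath ω) T) ⁻¹' {u}) = 0 := by
    rw [measureReal_def, ENNReal.toReal_eq_zero_iff]
    left
    refine cond_absolutelyContinuous (measure_mono_null (fun ω hω => ?_)
      (ae_iff.1 ((ae_isPossible A W f).and (ae_arrivalTime_le W f h_arrival))))
    rintro ⟨h1, h2⟩
    have h3 : bitsAt (bitPath ω) T = u := hω
    exact hu (h3 ▸ (h1.eq_arrival h_length h2).1)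
  have hinj : Function.Injective (List.Vector.toList : List.Vector Bool n → List Bool) :=
    fun s s' h => Subtype.ext h
  rw [← hinj.tsum_eq, tsum_fintype, ← outputs_eq_sum_jointProb h_length h_arrival,
    Finset.mul_sum, Finset.sum_mul]
  · refine Finset.sum_congr rfl fun s _ => ?_
    have hcond (X : Set (ℕ → List Bool × 𝒴)) :
        (μ[|V]).real X = (μ.real V)⁻¹ * μ.real (V ∩ X) := by
      simp only [measureReal_def, cond_apply hVm, ENNReal.toReal_mul, ENNReal.toReal_inv]
    rw [hcond]
    have hj : μ.real (V ∩ (fun ω => bitsAt (bitPath ω) T) ⁻¹' {s.toList}) =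
        jointProb A W f T y s := by
      rw [Set.inter_comm]; rfl
    rw [hj]
    have hle : jointProb A W f T y s ≤ μ.real V := measureReal_mono fun ω h => h.2
    have h0 : 0 ≤ jointProb A W f T y s := measureReal_nonneg
    rcases h0.eq_or_lt with h | h
    · simp [← h]
    · have hVp : 0 < μ.real V := h.trans_le hle
      have hlog : Real.log ((μ.real V)⁻¹ * jointProb A W f T y s) =
          -Real.log (μ.real V / jointProb A W f T y s) := by
        rw [← Real.log_inv, inv_div, div_eq_inv_mul]
      change _ = jointProb A W f T y s * Real.log (μ.real V / jointProb A W f T y s)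
      rw [Real.negMulLog, hlog]
      field_simp
  · intro u hu
    by_contra hne
    refine hu ?_
    have : u.length ≠ n := fun h => hne ⟨⟨u, h⟩, rfl⟩
    simp [hzero u this]

open Classical in
lemma switchDeficit_le (hw : IsUniformChannel (fun x y => (W x y).toReal) m C₀ C₁)
    (h_length : ∀ t ≥ n, ∀ s : List Bool, s.length = n → A.trans t s s = 1)
    (h_arrival : ∀ᵐ b ∂A.law, arrivalTime n b ≤ T) (hε : 0 < ε) (hε1 : ε < 1) :
    switchDeficit A W f n T m C₀ C₁ ε T ≤ potentialBound m C₀ C₁ ε +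
      condEntropy (systemLaw A W f) (fun ω => bitsAt (bitPath ω) T) (outputs T) *
        Real.log 2 / C₀ := by
  have hC₀ := hw.C₀_pos
  have hC₁ := hw.C₁_pos
  have hm := hw.m_pos
  have hΦ : 0 ≤ potentialBound m C₀ C₁ ε := by
    have h1 := Real.log_nonpos hε.le hε1.le
    have h2 := Real.log_nonpos hw.m_pos.le hw.m_le_one
    have : 0 ≤ -Real.log ε - Real.log m := by linarith
    unfold potentialBound; positivity
  have hmass : ∑ y : Fin T → 𝒴, ∑ s, switchWeight A W f n T T y s = 1 := by
    have := systemLaw_switchEncoder_outputs (W := W) (f := f) h_length h_arrival le_rfl Set.univ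
    simpa using this.symm
  rw [condEntropy_mul_log_two h_length h_arrival, ← mul_one (potentialBound _ _ _ _), ← hmass,
    Finset.mul_sum, Finset.sum_div, ← Finset.sum_add_distrib]
  refine Finset.sum_le_sum fun y _ => ?_
  rw [← switchWeight_of_le le_rfl]
  have hq0 : ∀ s, 0 ≤ switchWeight A W f n T T y s := switchWeight_nonneg T y
  split_ifs with h
  · have := neg_avgPotential_le hw hq0 fun s => lt_sum_of_lt hq0 hε (lt_of_noPass le_rfl h s)
    linarith
  -- Output sequences that already pass at `T` contribute nothing on the left, and the right side is
  -- nonnegative.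
  · refine add_nonneg (mul_nonneg hΦ (Finset.sum_nonneg fun s _ => hq0 s))
      (div_nonneg (Finset.sum_nonneg fun s _ => ?_) hC₀.le)
    rcases (hq0 s).eq_or_lt with h0 | h0
    · simp [← h0]
    · refine mul_nonneg (hq0 s) (Real.log_nonneg ?_)
      rw [le_div_iff₀ h0, one_mul]
      exact Finset.single_le_sum (fun s _ => hq0 s) (Finset.mem_univ s)

/-- In the tail sum the times before `T` contribute at most `T`; from `T` on the tail probabilities
are bounded by decrements of the deficit, which telescope. -/
lemma lintegral_firstPass_le (hw : IsUniformChannel (fun x y => (W x y).toReal) m C₀ C₁)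
    (h_length : ∀ t ≥ n, ∀ s : List Bool, s.length = n → A.trans t s s = 1)
    (h_arrival : ∀ᵐ b ∂A.law, arrivalTime n b ≤ T) (hε : 0 < ε) (hε1 : ε < 1) :
    ∫⁻ ω, (firstPass (switchTest A W f n T ε) ω : ℝ≥0∞)
      ∂systemLaw A W (switchEncoder A W f n T) ≤
      ENNReal.ofReal (T + switchDeficit A W f n T m C₀ C₁ ε T) := by
  classical
  set μ := systemLaw A W (switchEncoder A W f n T) with hμ
  set p := switchTest A W f n T ε with hp
  have hpartial (N : ℕ) : ∑ k ∈ Finset.range N, μ.real {ω | NoPass p (k + T) (outputs (k + T) ω)} +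
      switchDeficit A W f n T m C₀ C₁ ε (N + T) ≤ switchDeficit A W f n T m C₀ C₁ ε T := by
    induction N with
    | zero => simp
    | succ N ih =>
      have h1 := switchDeficit_succ_le (A := A) (f := f) (n := n) hw hε hε1
        (Nat.le_add_left T N)
      have h2 := systemLaw_switchEncoder_outputs (W := W) (f := f) h_length h_arrival
        (Nat.le_add_left T N) {y | NoPass p (N + T) y}
      have h3 : μ.real {ω | NoPass p (N + T) (outputs (N + T) ω)} = _ := h2
      rw [Finset.sum_range_succ, h3, show N + 1 + T = N + T + 1 by ring]
      simp only [Set.mem_ofPred_eq]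
      linarith
  rw [lintegral_firstPass, ← Summable.sum_add_tsum_nat_add' (k := T) ENNReal.summable,
    ENNReal.ofReal_add (Nat.cast_nonneg T) (switchDeficit_nonneg hw hε hε1 le_rfl)]
  refine add_le_add ?_ (ENNReal.tsum_le_of_sum_range_le fun N => ?_)
  · calc _ ≤ ∑ _t ∈ Finset.range T, (1 : ℝ≥0∞) := Finset.sum_le_sum fun t _ => prob_le_one
      _ = _ := by simp
  · have h1 := hpartial N
    have h2 := switchDeficit_nonneg (A := A) (f := f) (n := n) hw hε hε1 (Nat.le_add_left T N)
    calc _ = ENNReal.ofReal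
          (∑ k ∈ Finset.range N, μ.real {ω | NoPass p (k + T) (outputs (k + T) ω)}) := by
          rw [ENNReal.ofReal_sum_of_nonneg fun _ _ => measureReal_nonneg]
          exact Finset.sum_congr rfl fun k _ => (ofReal_measureReal (measure_ne_top _ _)).symm
      _ ≤ _ := ENNReal.ofReal_le_ofReal (by linarith)

/-- For each output sequence that stops at `t`, the decoded message carries at least a fraction `1 -
ε` of the weight, leaving at most `ε` for all others. -/
lemma measure_decodingError_le
    (h_length : ∀ t ≥ n, ∀ s : List Bool, s.length = n → A.trans t s s = 1)
    (h_arrival : ∀ᵐ b ∂A.law, arrivalTime n b ≤ T) (hε : 0 < ε) (t : ℕ) :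
    systemLaw A W (switchEncoder A W f n T) {ω | firstPass (switchTest A W f n T ε) ω = t ∧
      ∃ s : List.Vector Bool n, bitsAt (bitPath ω) T = s.toList ∧
        s ≠ switchDecoder A W f n T ε t (outputs t ω)} ≤
      ENNReal.ofReal ε * systemLaw A W (switchEncoder A W f n T)
        {ω | firstPass (switchTest A W f n T ε) ω = t} := by
  classical
  set μ := systemLaw A W (switchEncoder A W f n T) with hμ
  set p := switchTest A W f n T ε with hp
  rcases lt_or_ge t T with ht | ht
  · refine (measure_mono_null (fun ω hω => ?_) measure_empty).le.trans zero_le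
    have := (firstPass_eq_iff.1 hω.1).1.1
    omega
  let K : Set (Fin t → 𝒴) := {y | p t y ∧ ∀ t' (h : t' < t), ¬ p t' fun i => y (Fin.castLE h.le i)}
  have e1 : {ω : ℕ → List Bool × 𝒴 | firstPass p ω = t} = {ω | outputs t ω ∈ K} := by
    ext ω; exact firstPass_eq_iff
  have e2 : {ω : ℕ → List Bool × 𝒴 | firstPass p ω = t ∧ ∃ s : List.Vector Bool n,
      bitsAt (bitPath ω) T = s.toList ∧ s ≠ switchDecoder A W f n T ε t (outputs t ω)} =
      {ω | ∃ s : List.Vector Bool n, bitsAt (bitPath ω) T = s.toList ∧ (outputs t ω, s) ∈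
        {q : (Fin t → 𝒴) × List.Vector Bool n |
          q.1 ∈ K ∧ q.2 ≠ switchDecoder A W f n T ε t q.1}} := by
    ext ω
    constructor
    · rintro ⟨h, s, h1, h2⟩; exact ⟨s, h1, firstPass_eq_iff.1 h, h2⟩
    · rintro ⟨s, h1, h, h2⟩; exact ⟨firstPass_eq_iff.2 h, s, h1, h2⟩
  rw [e1, e2, ← ofReal_measureReal (measure_ne_top μ _),
    ← ofReal_measureReal (μ := μ) (s := {ω | outputs t ω ∈ K}) (measure_ne_top μ _),
    ← ENNReal.ofReal_mul hε.le]
  refine ENNReal.ofReal_le_ofReal ?_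
  rw [hμ, systemLaw_switchEncoder_event h_length ht,
    systemLaw_switchEncoder_outputs h_length h_arrival ht, Finset.mul_sum]
  refine Finset.sum_le_sum fun y _ => ?_
  by_cases hy : y ∈ K
  · have h1 := le_switchWeight_switchDecoder hy.1
    set q := switchWeight A W f n T t y with hq
    set s₀ := switchDecoder A W f n T ε t y with hs₀
    have h2 : ∑ s, (if (y, s) ∈ {q : (Fin t → 𝒴) × List.Vector Bool n |
        q.1 ∈ K ∧ q.2 ≠ switchDecoder A W f n T ε t q.1} then q s else 0) =
        ∑ s, q s - q s₀ := by
      rw [← Finset.add_sum_erase _ q (Finset.mem_univ s₀), add_sub_cancel_left,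
        ← Finset.add_sum_erase _ _ (Finset.mem_univ s₀), if_neg fun h => h.2 rfl, zero_add]
      refine Finset.sum_congr rfl fun s hs => if_pos ⟨hy, Finset.ne_of_mem_erase hs⟩
    rw [h2, if_pos hy]
    linarith
  · rw [if_neg hy, mul_zero]
    refine (Finset.sum_eq_zero fun s _ => if_neg fun h => hy h.1).le

/-- A code that follows an arbitrary encoder up to a time `T` by which all bits have arrived, and
afterwards needs the mean time `H(B_T | Y^T) / C + log (1 / ε) / C₁ + O(1)`. -/
theorem exists_feedbackCode (hw : IsUniformChannel (fun x y => (W x y).toReal) m C₀ C₁)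
    (h_length : ∀ t ≥ n, ∀ s : List Bool, s.length = n → A.trans t s s = 1)
    (h_arrival : ∀ᵐ b ∂A.law, arrivalTime n b ≤ T) (hT : 1 ≤ T) (f : Encoder (Fin 2) 𝒴)
    (hε : 0 < ε) (hε1 : ε < 1) {S : ℝ}
    (hS : T + (potentialBound m C₀ C₁ ε +
      condEntropy (systemLaw A W f) (fun ω => bitsAt (bitPath ω) T) (outputs T) *
        Real.log 2 / C₀) ≤ S) :
    Nonempty (FeedbackCode A W n (ENNReal.ofReal S) (ENNReal.ofReal ε)) := by
  have hmean := lintegral_firstPass_le (f := f) hw h_length h_arrival hε hε1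
  have hdef := switchDeficit_le (f := f) hw h_length h_arrival hε hε1
  refine ⟨{ enc := switchEncoder A W f n T
            dec := switchDecoder A W f n T ε
            stopTime := firstPass (switchTest A W f n T ε)
            isStoppingTime := isStoppingTime_firstPass _
            one_le_stopTime := fun ω => le_iInf₂ fun t ht => ?_
            mean_le := hmean.trans (ENNReal.ofReal_le_ofReal (by linarith))
            error_le := ?_ }⟩
  · exact_mod_cast hT.trans ht.1
  set μ := systemLaw A W (switchEncoder A W f n T) with hμ
  set p := switchTest A W f n T ε with hp
  -- Never stopping counts as an error, so almost sure finiteness is needed; it follows from the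
  -- finite mean.
  have hfin : ∀ᵐ ω ∂μ, (firstPass p ω : ℝ≥0∞) < ⊤ := by
    refine ae_lt_top' ?_ (hmean.trans_lt ENNReal.ofReal_lt_top).ne
    have hm (t : ℕ) : MeasurableSet {ω : ℕ → List Bool × 𝒴 | (t : ℕ∞) < firstPass p ω} := by
      simp only [lt_firstPass_iff]
      exact measurableSet_outputs_mem t {y | NoPass p t y}
    simp only [toENNReal_eq_tsum_lt]
    exact (Measurable.tsum fun t =>
      Measurable.ite (hm t) measurable_const measurable_const).aemeasurable
  have hsub : {ω : ℕ → List Bool × 𝒴 | ∃ t k : ℕ, firstPass p ω = t ∧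
      arrivalTime n (bitPath ω) = k ∧
      (switchDecoder A W f n T ε t (outputs t ω)).toList = bitsAt (bitPath ω) k}ᶜ ≤ᵐ[μ]
      ⋃ t : ℕ, {ω | firstPass p ω = t ∧ ∃ s : List.Vector Bool n,
        bitsAt (bitPath ω) T = s.toList ∧ s ≠ switchDecoder A W f n T ε t (outputs t ω)} := by
    filter_upwards [hfin, ae_isPossible A W (switchEncoder A W f n T),
      ae_arrivalTime_le W (switchEncoder A W f n T) h_arrival] with ω h1 h2 h3 h4
    obtain ⟨hl, k, hk, hkT⟩ := h2.eq_arrival h_length h3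
    obtain ⟨t, ht⟩ := ENat.ne_top_iff_exists.1 (ENat.toENNReal_lt_top.1 h1).ne
    refine Set.mem_iUnion.2 ⟨t, ht.symm, ⟨_, hl⟩, rfl, fun h => h4 ⟨t, k, ht.symm, hk, ?_⟩⟩
    rw [← h, hkT]
    rfl
  refine (measure_mono_ae hsub).trans ((measure_iUnion_le _).trans ?_)
  refine (ENNReal.tsum_le_tsum fun t =>
    measure_decodingError_le (W := W) (f := f) h_length h_arrival hε t).trans ?_
  rw [ENNReal.tsum_mul_left]
  refine mul_le_of_le_one_right zero_le ?_
  rw [← measure_iUnion]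
  · exact prob_le_one
  · intro t t' htt'
    refine Set.disjoint_left.2 fun ω h1 h2 => htt' ?_
    exact_mod_cast (h1 : firstPass p ω = t).symm.trans h2
  · intro t
    have : {ω : ℕ → List Bool × 𝒴 | firstPass p ω = t} = {ω | outputs t ω ∈
        {y | p t y ∧ ∀ t' (h : t' < t), ¬ p t' fun i => y (Fin.castLE h.le i)}} := by
      ext ω; exact firstPass_eq_iff
    rw [this]
    exact measurableSet_outputs_mem t _

end Code

/-! ### From codes of each length to the error exponent -/

section Reliability

variable {𝒴 : Type*} [Fintype 𝒴] [MeasurableSpace 𝒴] [MeasurableSingletonClass 𝒴]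

lemma ae_arrivalTime_le_floor {A : BitArrival} {n d : ℕ} (h_mean : A.meanArrival n ≠ ⊤)
    (h : ∀ᵐ b ∂A.law, (arrivalTime n b : ℝ≥0∞) ≤ A.meanArrival n + (d : ℝ≥0∞)) :
    ∀ᵐ b ∂A.law, arrivalTime n b ≤ (⌊(A.meanArrival n).toReal⌋₊ + d : ℕ) := by
  filter_upwards [h] with b hb
  have hne : arrivalTime n b ≠ ⊤ := by
    intro htop
    rw [htop, ENat.toENNReal_top, top_le_iff] at hb
    exact ENNReal.add_ne_top.2 ⟨h_mean, ENNReal.natCast_ne_top d⟩ hb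
  obtain ⟨k, hk⟩ := ENat.ne_top_iff_exists.1 hne
  rw [← hk] at hb ⊢
  have hb' : (k : ℝ) ≤ (A.meanArrival n).toReal + d := by
    have := ENNReal.toReal_mono (ENNReal.add_ne_top.2 ⟨h_mean, ENNReal.natCast_ne_top d⟩) hb
    rwa [ENNReal.toReal_add h_mean (ENNReal.natCast_ne_top d), ENNReal.toReal_natCast,
      ENat.toENNReal_coe, ENNReal.toReal_natCast] at this
  rw [← Nat.floor_add_natCast ENNReal.toReal_nonneg]
  exact_mod_cast Nat.le_floor hb'

lemma one_le_meanArrival (A : BitArrival) {n : ℕ} (hn : 1 ≤ n) : 1 ≤ A.meanArrival n := by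
  have h1 (b : ℕ → List Bool) : (1 : ℝ≥0∞) ≤ arrivalTime n b := by
    have : ((1 : ℕ) : ℕ∞) ≤ arrivalTime n b := by
      refine le_iInf₂ fun t ht => ?_
      rcases t with _ | t
      · simp [bitsAt] at ht; omega
      · exact_mod_cast Nat.le_add_left 1 t
    have := ENat.toENNReal_le.2 this
    simpa using this
  calc (1 : ℝ≥0∞) = ∫⁻ _, 1 ∂A.law := by simp
    _ ≤ _ := lintegral_mono h1

/-- A code that ignores the message and stops at time `1`; it covers the lengths at which the
claimed exponent is not positive. -/
lemma minError_le_one (A : BitArrival) (W : Fin 2 → PMF 𝒴) {n : ℕ} {R : ℝ}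
    (h : 1 ≤ (n : ℝ) / R) : minError A W n R ≤ 1 := by
  refine sInf_le ⟨{
    enc := fun _ _ _ => 0
    dec := fun _ _ => List.Vector.replicate n false
    stopTime := fun _ => (1 : ℕ)
    isStoppingTime := isStoppingTime_const _ 1
    one_le_stopTime := fun _ => le_rfl
    mean_le := ?_
    error_le := prob_le_one }⟩
  simpa using h

/-- The exponent attained by codes of length `n`. -/
lemma le_exponent_of_minError_le {e : ℝ≥0∞} {R G : ℝ} {n : ℕ} (hR : 0 < R)
    (h : e ≤ ENNReal.ofReal (Real.exp (-G))) :
    ((R / n * (G / Real.log 2) : ℝ) : EReal) ≤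
      ((R / n : ℝ) : EReal) * (ENNReal.log e⁻¹ / (Real.log 2 : ℝ)) := by
  have hl2 : 0 < Real.log 2 := Real.log_pos one_lt_two
  rw [EReal.coe_mul]
  refine mul_le_mul_of_nonneg_left ?_ (EReal.coe_nonneg.2 (by positivity))
  rw [EReal.coe_div]
  refine EReal.div_le_div_right_of_nonneg (EReal.coe_nonneg.2 hl2.le) ?_
  have h1 : ENNReal.ofReal (Real.exp G) ≤ e⁻¹ := by
    rw [ENNReal.le_inv_iff_le_inv, ← ENNReal.ofReal_inv_of_pos (Real.exp_pos G), ← Real.exp_neg]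
    exact h
  have h2 := ENNReal.log_le_log h1
  rwa [ENNReal.log_ofReal_of_pos (Real.exp_pos G), Real.log_exp] at h2

/-- Every real `x` above the limit superior eventually dominates `X n`, so it suffices to let `x`
approach that value. The limit superior may be infinite, hence the three cases. -/
lemma le_liminf_of_asymptotic {r : ℕ → EReal} {X δ : ℕ → ℝ} {C R : ℝ} (hC : 0 < C) (hR : 0 < R)
    (hδ : Tendsto δ atTop (𝓝 0))
    (h : ∀ᶠ n in atTop, ((C * (1 - X n * R) - δ n : ℝ) : EReal) ≤ r n) :
    (C : EReal) * (1 - limsup (fun n => (X n : EReal)) atTop * R) ≤ liminf r atTop := by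
  set l := limsup (fun n => (X n : EReal)) atTop with hl
  have key : ∀ x a : ℝ, l < x → a < C * (1 - x * R) → (a : EReal) ≤ liminf r atTop := by
    intro x a hx ha
    refine le_liminf_of_le (by isBoundedDefault) ?_
    have h1 := eventually_lt_of_limsup_lt hx
    have h2 : ∀ᶠ n in atTop, δ n < C * (1 - x * R) - a := hδ.eventually_lt_const (by linarith)
    filter_upwards [h, h1, h2] with n h3 h4 h5
    refine le_trans (EReal.coe_le_coe_iff.2 ?_) h3
    have h4 : X n < x := EReal.coe_lt_coe_iff.1 h4
    have : C * (1 - x * R) ≤ C * (1 - X n * R) := by gcongr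
    linarith
  induction hlv : l using EReal.rec with
  | top =>
    rw [EReal.top_mul_coe_of_pos hR]
    simp [EReal.coe_mul_bot_of_pos hC]
  | bot =>
    refine le_of_le_of_eq le_top (Eq.symm ?_)
    refine EReal.eq_top_iff_forall_lt _ |>.2 fun a => ?_
    -- This `x` solves `C * (1 - x * R) = a + 2`, leaving room above `a + 1`.
    have := key ((1 - (a + 2) / C) / R) (a + 1) (by rw [hlv]; exact EReal.bot_lt_coe _) (by
      have : C * (1 - (1 - (a + 2) / C) / R * R) = a + 2 := by field_simp; ring
      rw [this]; linarith)
    exact lt_of_lt_of_le (EReal.coe_lt_coe_iff.2 (by linarith)) this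
  | coe v =>
    have hcoe : (C : EReal) * (1 - (v : EReal) * R) = ((C * (1 - v * R) : ℝ) : EReal) := by
      push_cast; rfl
    rw [hcoe]
    refine EReal.ge_of_forall_gt_iff_ge.1 fun a ha => ?_
    have ha : a < C * (1 - v * R) := EReal.coe_lt_coe_iff.1 ha
    -- Moving `v` by `η` uses up half of the gap to `a`.
    set η := (C * (1 - v * R) - a) / (2 * C * R) with hη
    have hη0 : 0 < η := div_pos (by linarith) (by positivity)
    refine key (v + η) a (by rw [hlv]; exact EReal.coe_lt_coe_iff.2 (by linarith)) ?_
    have : C * (1 - (v + η) * R) = C * (1 - v * R) - (C * (1 - v * R) - a) / 2 := by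
      rw [hη]; field_simp; ring
    rw [this]; linarith

end Reliability

end InstantSED

theorem theorem1 {𝒴 : Type*} [Fintype 𝒴] [MeasurableSpace 𝒴] [MeasurableSingletonClass 𝒴]
    (A : ℕ → BitArrival) (d : ℕ → ℕ) (W : Fin 2 → PMF 𝒴)
    -- the message of `A n` has `n` bits
    (h_length : ∀ n ≥ 1, ∀ t ≥ n, ∀ s : List Bool, s.length = n → (A n).trans t s s = 1)
    -- `τ_n ≤ E[τ_n] + d(n) < ∞` almost surely, and `d(n) = o(n)`
    (h_mean : ∀ n ≥ 1, (A n).meanArrival n ≠ ⊤)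
    (h_arrival : ∀ n ≥ 1, ∀ᵐ b ∂(A n).law,
      (arrivalTime n b : ℝ≥0∞) ≤ (A n).meanArrival n + (d n : ℝ≥0∞))
    (h_d : (fun n => (d n : ℝ)) =o[atTop] fun n : ℕ => (n : ℝ))
    -- the channel has positive capacity, achieved by the uniform input distribution
    (h_pos : 0 < capacity W)
    (h_unif : IsCapacityAchieving W (PMF.uniformOfFintype (Fin 2)))
    -- `C₁` is attained at the pair of inputs `(0, 1)`
    (h_max : relEntropy (W 0) (W 1) = maxRelEntropy W)
    -- all transition probabilities are positive
    (h_full : ∀ x y, 0 < W x y)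
    -- `f n` is the encoder of an instantaneous SED code for the arrival distribution `A n`
    (f : ℕ → Encoder (Fin 2) 𝒴)
    (h_sed : ∀ n ≥ 1, IsSEDEncoder (A n) W (PMF.uniformOfFintype (Fin 2)) (f n))
    (R : ℝ) (hR : 0 < R) :
    let T : ℕ → ℕ := fun n => ⌊((A n).meanArrival n).toReal⌋₊ + d n
    let H : ℕ → ℝ := fun n => condEntropy (systemLaw (A n) W (f n))
      (fun ω => bitsAt (bitPath ω) (T n)) (outputs (T n))
    (maxRelEntropy W : EReal) *
        (1 - limsup (fun n : ℕ =>
          ((H n / (n * capacity W) + ((A n).meanArrival n).toReal / n : ℝ) : EReal)) atTop * R) ≤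
      reliability A W R := by
  intro T H
  obtain ⟨m, hw⟩ := isUniformChannel_of_isCapacityAchieving h_full h_pos h_unif h_max
  have hl2 : 0 < Real.log 2 := Real.log_pos one_lt_two
  have hC₁ : 0 < maxRelEntropy W := pos_of_mul_pos_left hw.C₁_pos hl2.le
  -- The part of `potentialBound` that does not depend on `ε`.
  set κ : ℝ := -Real.log m / (maxRelEntropy W * Real.log 2) + 1 / (m * (capacity W * Real.log 2))
    with hκ
  refine le_liminf_of_asymptotic
    (δ := fun n => maxRelEntropy W * R * ((d n : ℝ) / n + κ / n)) hC₁ hR ?_ ?_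
  · have h1 : Tendsto (fun n : ℕ => (d n : ℝ) / n) atTop (𝓝 0) := h_d.tendsto_div_nhds_zero
    have h2 := tendsto_const_div_atTop_nhds_zero_nat κ
    simpa using (h1.add h2).const_mul (maxRelEntropy W * R)
  · filter_upwards [eventually_ge_atTop (max 1 ⌈R⌉₊)] with n hn
    have hn1 : 1 ≤ n := (le_max_left _ _).trans hn
    have hn0 : (0 : ℝ) < n := by exact_mod_cast hn1
    have hnR : 1 ≤ (n : ℝ) / R := by
      rw [one_le_div hR]
      exact Nat.ceil_le.1 ((le_max_right _ _).trans hn)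
    have hτ : 1 ≤ ((A n).meanArrival n).toReal := by
      have := ENNReal.toReal_mono (h_mean n hn1) (one_le_meanArrival (A n) hn1)
      simpa using this
    have hT1 : 1 ≤ T n := le_add_right (Nat.le_floor (by exact_mod_cast hτ))
    have hTle : (T n : ℝ) ≤ ((A n).meanArrival n).toReal + d n := by
      have := Nat.floor_le (zero_le_one.trans hτ)
      simp only [T]
      push_cast
      linarith
    -- With `ε = exp (-G)`, this choice makes the bound on the mean stopping time equal to `n / R`.
    set G : ℝ := maxRelEntropy W * Real.log 2 * (n / R - T n - κ - H n / capacity W) with hG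
    have hlow : maxRelEntropy W * (1 - (H n / (n * capacity W) +
        ((A n).meanArrival n).toReal / n) * R) - maxRelEntropy W * R * ((d n : ℝ) / n + κ / n) ≤
        R / n * (G / Real.log 2) := by
      have h1 : R / n * (G / Real.log 2) = maxRelEntropy W * (1 - (H n / (n * capacity W) +
          ((A n).meanArrival n).toReal / n) * R) - maxRelEntropy W * R * ((d n : ℝ) / n + κ / n) +
          maxRelEntropy W * R / n * (((A n).meanArrival n).toReal + d n - T n) := by
        rw [hG]; field_simp; ring
      have h2 : 0 ≤ maxRelEntropy W * R / n * (((A n).meanArrival n).toReal + d n - T n) :=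
        mul_nonneg (by positivity) (by linarith)
      linarith
    refine (EReal.coe_le_coe_iff.2 hlow).trans ?_
    -- For `G ≤ 0` the value `exp (-G)` is no longer below one, but then the trivial code already
    -- beats the bound.
    rcases le_or_gt G 0 with hG0 | hG0
    · refine (EReal.coe_le_coe_iff.2 (?_ : _ ≤ R / n * (0 / Real.log 2))).trans
        (le_exponent_of_minError_le hR (by simpa using minError_le_one (A n) W hnR))
      gcongr
    · refine le_exponent_of_minError_le hR (sInf_le ?_)
      refine exists_feedbackCode hw (h_length n hn1)
        (ae_arrivalTime_le_floor (h_mean n hn1) (h_arrival n hn1)) hT1 (f n) (Real.exp_pos _)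
        (Real.exp_lt_one_iff.2 (by linarith)) (le_of_eq ?_)
      have h1 : potentialBound m (capacity W * Real.log 2) (maxRelEntropy W * Real.log 2)
          (Real.exp (-G)) = G / (maxRelEntropy W * Real.log 2) + κ := by
        rw [potentialBound, Real.log_exp, hκ]; ring
      have h2 : G / (maxRelEntropy W * Real.log 2) = n / R - T n - κ - H n / capacity W := by
        rw [hG]; field_simp
      have h3 : H n * Real.log 2 / (capacity W * Real.log 2) = H n / capacity W := by
        field_simp
      rw [h1, h2]
      change (T n : ℝ) + (n / R - T n - κ - H n / capacity W + κ +
        H n * Real.log 2 / (capacity W * Real.log 2)) = n / R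
      rw [h3]; ring
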